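/- Let $U\subseteq\mathbb C$ be open and connected, let $f$ be a meromorphic function on $U$, and let $z_0\in U$ be a simple root of $f$ (that is, $f(z_0)=0\ne f'(z_0)$) with $f''(z_0)\neq 0$. Let $\phi=\frac12(1+\sqrt5)$. The secant map is $$S_f(x,y)=\left(\frac{f(x)y-f(y)x}{f(x)-f(y)},\,x\right),$$ defined at those points $(x,y)\in U\times U$ to which the first coordinate, given by this formula where $f$ is holomorphic at $x$ and $y$ and $f(x)\ne f(y)$, extends as a holomorphic $\mathbb C$-valued function, with the value of that extension. Let $\mathcal A$ be the basin of $(z_0,z_0)$: the set of $(x,y)\in U\times U$ all of whose iterates $S_f^n(x,y)$ are defined and lie in the domain of $S_f$, with $S_f^n(x,y)\to(z_0,z_0)$. Write $\pi_1(x,y)=x$. For $w_0\in\mathbb C$ with $e^{w_0}=\frac{f''(z_0)}{2f'(z_0)}$, call a pair $(V,H)$ a *Böttcher-type function for $w_0$* if $V\subseteq\mathbb C^2$ is open, $(z_0,z_0)\in V\subseteq\mathcal A$, $S_f(V)\subseteq V$, and $H:V\to\mathbb C$ is holomorphic with $$H(z_0,z_0)=\exp\left(\tfrac{5+3\sqrt5}{10}\,w_0\right)\quad\text{and}\quad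 \lim_{n\to\infty}\left|\pi_1(S_f^n(x,y))-z_0\right|^{1/\phi^n}=|H(x,y)|\cdot|x-z_0|^{\phi/\sqrt5}\cdot|y-z_0|^{1/\sqrt5}$$ for all $(x,y)\in V$. 1. For every such $w_0$ there exists a Böttcher-type function for $w_0$. 2. For every such $w_0$, any two Böttcher-type functions $(V_1,H_1)$, $(V_2,H_2)$ for $w_0$ agree on the connected component of $V_1\cap V_2$ that contains $(z_0,z_0)$ (so they define the same holomorphic germ at $(z_0,z_0)$, and they agree on all of $V_1\cap V_2$ if this set is connected). 3. There is a unique continuous function $\widehat H:\mathcal A\to\mathbb R$ such that $$\lim_{n\to\infty}\left|\pi_1(S_f^n(x,y))-z_0\right|^{1/\phi^n}=\widehat H(x,y)\cdot|x-z_0|^{\phi/\sqrt5}\cdot|y-z_0|^{1/\sqrt5}\qquad\text{for all }(x,y)\in\mathcal A,$$ and it satisfies $\widehat H=|H|$ on $V$ for every Böttcher-type function $(V,H)$ for every such $w_0$. 4. There is a unique holomorphic $G:\mathcal A\to\mathbb C$ with $S_f(x,y)=\left(z_0+G(x,y)(x-z_0)(y-z_0),\,x\right)$ on $\mathcal A$;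 it has $G(z_0,z_0)=\frac{f''(z_0)}{2f'(z_0)}$, and $$\widehat H(x,y)=\left[\widehat H(S_f(x,y))\right]^{1/\phi}\cdot|G(x,y)|^{1/\sqrt5}\qquad\text{for all }(x,y)\in\mathcal A.$$ Moreover $\widehat H$ is real-analytic at every point of $\mathcal A$ where it is nonzero. -/

import Mathlib

/-- The pairs `(x, y)` at which the secant expression can be evaluated literally: `f` is
holomorphic at `x` and at `y`, and `f x ≠ f y`. -/
def secantRegular (f : ℂ → ℂ) : Set (ℂ × ℂ) :=
  {p | AnalyticAt ℂ f p.1 ∧ AnalyticAt ℂ f p.2 ∧ f p.1 ≠ f p.2}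

/-- The secant expression `(f(x) y - f(y) x) / (f(x) - f(y))`. -/
noncomputable def secantQuotient (f : ℂ → ℂ) (p : ℂ × ℂ) : ℂ :=
  (f p.1 * p.2 - f p.2 * p.1) / (f p.1 - f p.2)

/-- The points of `U × U` at which the secant map is defined with values in `ℂ × ℂ`, that is, to
which the secant expression extends holomorphically. Besides the pairs in `secantRegular f`, this
set contains the diagonal points where Newton's map is holomorphic and the pairs for which exactly
one entry is a pole of `f`; it does not contain points of indeterminacy and points where
the value is `∞`. -/
def secantDomain (f : ℂ → ℂ) (U : Set ℂ) : Set (ℂ × ℂ) :=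
  {p | p.1 ∈ U ∧ p.2 ∈ U ∧
    ∃ s : ℂ × ℂ → ℂ, AnalyticAt ℂ s p ∧ ∀ᶠ q in nhds p, q ∈ secantRegular f → s q = secantQuotient f q}

/-- The secant map `S_f(x, y) = ((f(x) y - f(y) x) / (f(x) - f(y)), x)`, where the first coordinate
is the value at `(x, y)` of the holomorphic extension of the secant expression, written as the limit
along the pairs in `secantRegular f`. Only its values on `secantDomain f U` are meaningful. -/
noncomputable def secantMap (f : ℂ → ℂ) (p : ℂ × ℂ) : ℂ × ℂ :=
  (Filter.limUnder (nhdsWithin p (secantRegular f)) (secantQuotient f), p.1)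

/-- The basin of attraction of `(z₀, z₀)`: all iterates are defined (and so stay in `U × U`) and they
converge to `(z₀, z₀)`. -/
def secantBasin (f : ℂ → ℂ) (U : Set ℂ) (z₀ : ℂ) : Set (ℂ × ℂ) :=
  {p | (∀ n : ℕ, (secantMap f)^[n] p ∈ secantDomain f U) ∧
    Filter.Tendsto (fun n : ℕ => (secantMap f)^[n] p) Filter.atTop (nhds (z₀, z₀))}

/-- `G` is holomorphic on the basin, and `S_f(x, y) = (z₀ + G(x, y) (x - z₀) (y - z₀), x)` there. -/
def IsSecantFactor (f : ℂ → ℂ) (U : Set ℂ) (z₀ : ℂ) (G : ℂ × ℂ → ℂ) : Prop :=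
  AnalyticOnNhd ℂ G (secantBasin f U z₀) ∧
  ∀ p ∈ secantBasin f U z₀, secantMap f p = (z₀ + G p * (p.1 - z₀) * (p.2 - z₀), p.1)

/-- `|π₁ S_fⁿ(x, y) - z₀| ^ (1 / φⁿ)` converges to `m |x - z₀| ^ (φ / √5) |y - z₀| ^ (1 / √5)`, for
the point `p = (x, y)`. -/
def HasSecantLimit (f : ℂ → ℂ) (z₀ : ℂ) (p : ℂ × ℂ) (m : ℝ) : Prop :=
  Filter.Tendsto
    (fun n : ℕ => ‖((secantMap f)^[n] p).1 - z₀‖ ^ (1 / Real.goldenRatio ^ n : ℝ)) Filter.atTop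
    (nhds (m * ‖p.1 - z₀‖ ^ (Real.goldenRatio / √5 : ℝ) * ‖p.2 - z₀‖ ^ (1 / √5 : ℝ)))

/-- `H` is a Böttcher-type function with domain `V`, for the logarithm `w₀`: `V` is a forward-invariant
open neighbourhood of `(z₀, z₀)` in the basin, and `H` is holomorphic on `V` with the prescribed value
at `(z₀, z₀)` and the limit formula on `V`. -/
def IsBottcherFunction (f : ℂ → ℂ) (U : Set ℂ) (z₀ w₀ : ℂ) (V : Set (ℂ × ℂ)) (H : ℂ × ℂ → ℂ) : Prop :=
  IsOpen V ∧ (z₀, z₀) ∈ V ∧ V ⊆ secantBasin f U z₀ ∧ Set.MapsTo (secantMap f) V V ∧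
  AnalyticOnNhd ℂ H V ∧
  H (z₀, z₀) = Complex.exp (((5 + 3 * √5) / 10 : ℝ) * w₀) ∧
  ∀ p ∈ V, HasSecantLimit f z₀ p ‖H p‖

/-! The secant expression equals z₀ on both lines x = z₀ and y = z₀, so S_f has the normal form (z₀
+ G·(x - z₀)(y - z₀), x) with G holomorphic (`exists_secantFactor`), and G(z₀, z₀) =
f''(z₀)/(2f'(z₀)) ≠ 0. Along an orbit in the basin the distances to z₀ satisfy a (n+2) = |G|·a
(n+1)·a n. If none vanishes, their logarithms obey a Fibonacci recursion with bounded forcing log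
|G|. Splitting it along the eigenvalues φ and -1/φ gives the limit, with leading factor the product
of |G ∘ S_f^k| ^ (φ^(-k)/√5) over k (`tendsto_rpow_inv_goldenRatio_pow`).

Near the fixed point G has a holomorphic logarithm with value w₀ at (z₀, z₀). Replacing log |G| by
it and exponentiating the series gives H (`exists_norm_eq_goldenProd`); uniform convergence and
Osgood's lemma make H holomorphic. Uniqueness holds because the limit fixes |H| off the two lines,
hence everywhere by continuity, and the modulus together with one nonzero value determines a
holomorphic germ.

Splitting off the factor k = 0 of the product gives the functional equation. It carries continuity
and, where the modulus is nonzero, real-analyticity from a neighbourhood of the fixed point back to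
the whole basin (`secantBasin_induction`). -/

open Filter Topology Metric

/-! ### Osgood's lemma and division by a coordinate in two variables -/

/-- The circle integral, as a continuous linear functional on the continuous functions on the
circle. -/
theorem exists_circleIntegral_functional (a : ℂ) {r : ℝ} (hr : 0 < r) :
    ∃ L : C(sphere a r, ℂ) →L[ℂ] ℂ, ∀ (g : C(sphere a r, ℂ)) (h : ℂ → ℂ),
      (∀ z : sphere a r, g z = h z) → L g = ∮ z in C(a, r), h z := by
  set γ : ℝ → sphere a r := fun θ => ⟨circleMap a r θ, circleMap_mem_sphere a hr.le θ⟩ with hγ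
  have hγc : Continuous γ := by
    rw [hγ]
    exact (continuous_circleMap a r).subtype_mk _
  have hdc : Continuous (deriv (circleMap a r)) := by
    have : deriv (circleMap a r) = fun θ => circleMap 0 r θ * Complex.I := by
      ext θ; simp
    rw [this]
    fun_prop
  have hint : ∀ g : C(sphere a r, ℂ), IntervalIntegrable
      (fun θ => deriv (circleMap a r) θ • g (γ θ)) MeasureTheory.volume 0 (2 * Real.pi) := fun g =>
    (hdc.smul (g.continuous.comp hγc)).intervalIntegrable _ _
  refine ⟨LinearMap.mkContinuous
    { toFun := fun g => ∫ θ in (0 : ℝ)..2 * Real.pi, deriv (circleMap a r) θ • g (γ θ)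
      map_add' := fun g h => by
        rw [← intervalIntegral.integral_add (hint g) (hint h)]
        simp [mul_add]
      map_smul' := fun c g => by
        rw [RingHom.id_apply, ← intervalIntegral.integral_smul]
        congr 1
        ext θ
        simp only [ContinuousMap.smul_apply, smul_eq_mul]
        ring } (r * |2 * Real.pi - 0|) ?_, ?_⟩
  · intro g
    have := intervalIntegral.norm_integral_le_of_norm_le_const (a := 0) (b := 2 * Real.pi)
      (f := fun θ => deriv (circleMap a r) θ • g (γ θ)) (C := r * ‖g‖) (fun θ _ => by
        simp only [deriv_circleMap, smul_eq_mul, norm_mul, norm_circleMap_zero, Complex.norm_I,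
          mul_one, abs_of_pos hr]
        gcongr
        exact g.norm_coe_le_norm _)
    calc _ ≤ _ := this
      _ = _ := by ring
  · intro g h hgh
    simp only [circleIntegral, LinearMap.mkContinuous_apply, LinearMap.coe_mk, AddHom.coe_mk]
    simp [hgh, hγ]

/-- The Cauchy kernel depends analytically on its pole, as a continuous function on the circle. -/
theorem exists_cauchyKernel (a : ℂ) (r : ℝ) :
    ∃ R : ℂ → C(sphere a r, ℂ), ∀ x ∈ ball a r, AnalyticAt ℂ R x ∧
      ∀ z : sphere a r, R x z = ((z : ℂ) - x)⁻¹ := by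
  set ι : C(sphere a r, ℂ) := ⟨Subtype.val, continuous_subtype_val⟩ with hι
  -- The kernel is an inverse in the Banach algebra of continuous functions on the circle, where
  -- inversion is analytic at units.
  refine ⟨fun x => Ring.inverse (ι - algebraMap ℂ _ x), fun x hx => ?_⟩
  have hne : ∀ z : sphere a r, (z : ℂ) - x ≠ 0 := by
    intro z hz
    have h1 := z.2
    rw [mem_sphere] at h1
    rw [mem_ball, ← sub_eq_zero.1 hz] at hx
    exact hx.ne h1
  have hu : IsUnit (ι - algebraMap ℂ C(sphere a r, ℂ) x) := by
    rw [ContinuousMap.isUnit_iff_forall_ne_zero]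
    exact hne
  constructor
  · obtain ⟨u, hu⟩ := hu
    have h1 : AnalyticAt ℂ Ring.inverse (ι - algebraMap ℂ C(sphere a r, ℂ) x) := by
      rw [← hu]; exact analyticAt_inverse u
    have h2 : AnalyticAt ℂ (fun x => ι - algebraMap ℂ C(sphere a r, ℂ) x) x :=
      analyticAt_const.sub ((Algebra.linearMap ℂ C(sphere a r, ℂ)).toContinuousLinearMap.analyticAt x)
    exact AnalyticAt.comp (f := fun x => ι - algebraMap ℂ C(sphere a r, ℂ) x) h1 h2
  · intro z
    have h1 := Ring.inverse_mul_cancel _ hu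
    have h2 := congrArg (fun g : C(sphere a r, ℂ) => g z) h1
    exact eq_inv_of_mul_eq_one_left h2

/-- A continuous function on a closed bidisc that is holomorphic in the second variable defines an
analytic map into the continuous functions on the boundary circle of the first disc. -/
theorem exists_analytic_slice {a b : ℂ} {r : ℝ} (hr : 0 < r) {f : ℂ × ℂ → ℂ}
    (hf : ContinuousOn f (closedBall a r ×ˢ closedBall b r))
    (hf₂ : ∀ x ∈ closedBall a r, DifferentiableOn ℂ (fun y => f (x, y)) (closedBall b r)) :
    ∃ Φ : ℂ → C(sphere a r, ℂ), ∀ y ∈ ball b r, AnalyticAt ℂ Φ y ∧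
      ∀ z : sphere a r, Φ y z = f (z, y) := by
  classical
  have hslice : ∀ y ∈ closedBall b r, Continuous fun z : sphere a r => f (z, y) := by
    intro y hy
    exact hf.comp_continuous (by fun_prop) fun z => ⟨sphere_subset_closedBall z.2, hy⟩
  set Φ₀ : ℂ → C(sphere a r, ℂ) :=
    fun y => if hy : y ∈ closedBall b r then ⟨fun z => f (z, y), hslice y hy⟩ else 0 with hΦ₀
  have hΦ₀z : ∀ y ∈ closedBall b r, ∀ z : sphere a r, Φ₀ y z = f (z, y) := by
    intro y hy z
    simp only [hΦ₀, dif_pos hy, ContinuousMap.coe_mk]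
  have hmem : ∀ θ, circleMap b r θ ∈ closedBall b r := fun θ => circleMap_mem_closedBall b hr.le θ
  -- Currying turns joint continuity into continuity for the sup norm.
  have hcont : Continuous fun θ : ℝ => Φ₀ (circleMap b r θ) := by
    set F : C(ℝ × sphere a r, ℂ) := ⟨fun q => f (q.2, circleMap b r q.1),
      hf.comp_continuous (by fun_prop) fun q => ⟨sphere_subset_closedBall q.2.2, hmem _⟩⟩ with hF
    have : (fun θ : ℝ => Φ₀ (circleMap b r θ)) = fun θ => F.curry θ := by
      ext θ z
      rw [hΦ₀z _ (hmem θ)]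
      rfl
    rw [this]
    exact F.curry.continuous
  have hci : CircleIntegrable Φ₀ b r := hcont.intervalIntegrable _ _
  lift r to NNReal using hr.le
  -- The witness is the Cauchy integral of the Banach-valued `Φ₀`. Evaluation at `z` commutes with
  -- the integral, so the scalar Cauchy formula identifies its values.
  have hps := hasFPowerSeriesOn_cauchy_integral hci (by exact_mod_cast hr)
  refine ⟨_, fun y hy => ⟨hps.analyticAt_of_mem (by simpa [Metric.eball_coe] using hy), fun z => ?_⟩⟩
  have hyne : ∀ θ, circleMap b r θ - y ≠ 0 := fun θ h => by
    rw [mem_ball, ← sub_eq_zero.1 h] at hy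
    exact hy.ne (circleMap_mem_sphere b hr.le θ)
  have hev := ContinuousLinearMap.intervalIntegral_comp_comm (ContinuousMap.evalCLM ℂ z : C(sphere a r, ℂ) →L[ℂ] ℂ)
    (μ := MeasureTheory.volume) (a := 0) (b := 2 * Real.pi)
    (f := fun θ => deriv (circleMap b r) θ • (circleMap b r θ - y)⁻¹ • Φ₀ (circleMap b r θ))
    (Continuous.intervalIntegrable (by
      simp only [deriv_circleMap]
      have h1 : Continuous fun θ => (circleMap b r θ - y)⁻¹ :=
        ((continuous_circleMap b r).sub continuous_const).inv₀ hyne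
      exact ((continuous_circleMap 0 r).mul continuous_const).smul (h1.smul hcont)) _ _)
  have hC := DifferentiableOn.circleIntegral_sub_inv_smul
    (hf₂ z (sphere_subset_closedBall z.2)) hy
  simp only [circleIntegral, ContinuousMap.smul_apply]
  simp only [circleIntegral] at hC
  simp only [ContinuousMap.evalCLM_apply, ContinuousMap.smul_apply, hΦ₀z _ (hmem _)] at hev
  rw [← hev, hC, smul_smul, inv_mul_cancel₀ (by simp [Real.pi_ne_zero]), one_smul]

/-- **Osgood's lemma** on a bidisc, with division by `x - a`: a continuous function that is
holomorphic in each variable is analytic at the centre `(a, b)`, and so is the quotient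
`(f (x, y) - f (a, y)) / (x - a)`. -/
theorem analyticAt_and_exists_div {a b : ℂ} {r : ℝ} (hr : 0 < r) {f : ℂ × ℂ → ℂ}
    (hf : ContinuousOn f (closedBall a r ×ˢ closedBall b r))
    (hf₁ : ∀ y ∈ closedBall b r, DifferentiableOn ℂ (fun x => f (x, y)) (closedBall a r))
    (hf₂ : ∀ x ∈ closedBall a r, DifferentiableOn ℂ (fun y => f (x, y)) (closedBall b r)) :
    AnalyticAt ℂ f (a, b) ∧ ∃ k : ℂ × ℂ → ℂ, AnalyticAt ℂ k (a, b) ∧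
      ∀ᶠ p in 𝓝 (a, b), f p - f (a, p.2) = (p.1 - a) * k p := by
  obtain ⟨L, hL⟩ := exists_circleIntegral_functional a hr
  obtain ⟨R, hR⟩ := exists_cauchyKernel a r
  obtain ⟨Φ, hΦ⟩ := exists_analytic_slice hr hf hf₂
  have ha : a ∈ ball a r := mem_ball_self hr
  have hb : b ∈ ball b r := mem_ball_self hr
  have hpi : (2 * Real.pi * Complex.I : ℂ) ≠ 0 := by simp [Real.pi_ne_zero]
  have hRa : AnalyticAt ℂ (fun p : ℂ × ℂ => R p.1) (a, b) :=
    AnalyticAt.comp (f := Prod.fst) (g := R) (x := (a, b)) (hR a ha).1 analyticAt_fst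
  have hΦa : AnalyticAt ℂ (fun p : ℂ × ℂ => Φ p.2) (a, b) :=
    AnalyticAt.comp (f := Prod.snd) (g := Φ) (x := (a, b)) (hΦ b hb).1 analyticAt_snd
  -- Cauchy's formula in x writes f as a continuous linear functional of a product of two
  -- one-variable analytic maps, which gives joint analyticity.
  have hform : ∀ x ∈ ball a r, ∀ y ∈ ball b r,
      (2 * Real.pi * Complex.I : ℂ)⁻¹ * L (R x * Φ y) = f (x, y) := by
    intro x hx y hy
    have hC := DifferentiableOn.circleIntegral_sub_inv_smul (hf₁ y (ball_subset_closedBall hy)) hx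
    rw [hL _ (fun z => (z - x)⁻¹ • f (z, y)) (fun z => by
      rw [ContinuousMap.mul_apply, (hR x hx).2, (hΦ y hy).2, smul_eq_mul]), hC, smul_eq_mul,
      inv_mul_cancel_left₀ hpi]
  have hnhds : ∀ᶠ p : ℂ × ℂ in 𝓝 (a, b), p.1 ∈ ball a r ∧ p.2 ∈ ball b r :=
    prod_mem_nhds (ball_mem_nhds a hr) (ball_mem_nhds b hr)
  refine ⟨?_, fun p => (2 * Real.pi * Complex.I : ℂ)⁻¹ * L (R a * (R p.1 * Φ p.2)), ?_, ?_⟩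
  · have : AnalyticAt ℂ (fun p : ℂ × ℂ => (2 * Real.pi * Complex.I : ℂ)⁻¹ * L (R p.1 * Φ p.2))
      (a, b) := analyticAt_const.mul ((L.analyticAt _).comp (hRa.mul hΦa))
    refine this.congr ?_
    filter_upwards [hnhds] with p hp using hform p.1 hp.1 p.2 hp.2
  · exact analyticAt_const.mul ((L.analyticAt _).comp (analyticAt_const.mul (hRa.mul hΦa)))
  · filter_upwards [hnhds] with p hp
    -- The resolvent identity exhibits the factor x - a before the functional is applied.
    have key : R p.1 - R a = (p.1 - a) • (R a * R p.1) := by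
      ext z
      have hne : ∀ x ∈ ball a r, (z : ℂ) - x ≠ 0 := fun x hx h => by
        have h1 := z.2
        rw [mem_sphere] at h1
        rw [mem_ball, ← sub_eq_zero.1 h] at hx
        exact hx.ne h1
      have h1 := hne a ha
      have h2 := hne _ hp.1
      simp only [ContinuousMap.sub_apply, ContinuousMap.smul_apply, ContinuousMap.mul_apply,
        (hR a ha).2, (hR _ hp.1).2, smul_eq_mul]
      field_simp
      ring
    have h3 : R p.1 * Φ p.2 - R a * Φ p.2 = (p.1 - a) • (R a * (R p.1 * Φ p.2)) := by
      rw [← sub_mul, key, smul_mul_assoc, mul_assoc]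
    have h4 := congrArg L h3
    rw [map_sub, map_smul, smul_eq_mul] at h4
    rw [← hform a ha p.2 hp.2, ← Prod.mk.eta (p := p), ← hform p.1 hp.1 p.2 hp.2, ← mul_sub, h4]
    ring

/-- **Osgood's lemma**: on an open subset of `ℂ × ℂ`, a continuous function that is holomorphic along
each coordinate line is analytic. -/
theorem analyticOnNhd_of_continuousOn_of_separately {s : Set (ℂ × ℂ)} (hs : IsOpen s)
    {f : ℂ × ℂ → ℂ} (hf : ContinuousOn f s)
    (hf₁ : ∀ p ∈ s, DifferentiableAt ℂ (fun x => f (x, p.2)) p.1)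
    (hf₂ : ∀ p ∈ s, DifferentiableAt ℂ (fun y => f (p.1, y)) p.2) : AnalyticOnNhd ℂ f s := by
  rintro ⟨a, b⟩ hp
  obtain ⟨r, hr, hrs⟩ := nhds_basis_closedBall.mem_iff.1 (hs.mem_nhds hp)
  rw [← closedBall_prod_same] at hrs
  exact (analyticAt_and_exists_div hr (hf.mono hrs)
    (fun y hy x hx => (hf₁ (x, y) (hrs ⟨hx, hy⟩)).differentiableWithinAt)
    (fun x hx y hy => (hf₂ (x, y) (hrs ⟨hx, hy⟩)).differentiableWithinAt)).1

theorem AnalyticAt.slice_fst {f : ℂ × ℂ → ℂ} {p : ℂ × ℂ} (hf : AnalyticAt ℂ f p) :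
    AnalyticAt ℂ (fun x => f (x, p.2)) p.1 :=
  AnalyticAt.comp (f := fun x => (x, p.2)) (g := f) hf (analyticAt_id.prod analyticAt_const)

theorem AnalyticAt.slice_snd {f : ℂ × ℂ → ℂ} {p : ℂ × ℂ} (hf : AnalyticAt ℂ f p) :
    AnalyticAt ℂ (fun y => f (p.1, y)) p.2 :=
  AnalyticAt.comp (f := fun y => (p.1, y)) (g := f) hf (analyticAt_const.prod analyticAt_id)

/-- Division of an analytic function of two variables by the first coordinate. -/
theorem AnalyticAt.exists_div_fst {f : ℂ × ℂ → ℂ} {p : ℂ × ℂ} (hf : AnalyticAt ℂ f p) :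
    ∃ k : ℂ × ℂ → ℂ, AnalyticAt ℂ k p ∧
      ∀ᶠ q in 𝓝 p, f q - f (p.1, q.2) = (q.1 - p.1) * k q := by
  obtain ⟨a, b⟩ := p
  obtain ⟨r, hr, hrs⟩ := nhds_basis_closedBall.mem_iff.1 hf.eventually_analyticAt
  rw [← closedBall_prod_same] at hrs
  exact (analyticAt_and_exists_div hr
    (fun q hq => (hrs hq : AnalyticAt ℂ f q).continuousAt.continuousWithinAt)
    (fun y hy x hx =>
      (AnalyticAt.slice_fst (p := (x, y)) (hrs ⟨hx, hy⟩)).differentiableAt.differentiableWithinAt)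
    (fun x hx y hy => (AnalyticAt.slice_snd (p := (x, y))
      (hrs ⟨hx, hy⟩)).differentiableAt.differentiableWithinAt)).2

theorem analyticAt_swap (p : ℂ × ℂ) : AnalyticAt ℂ (Prod.swap : ℂ × ℂ → ℂ × ℂ) p :=
  analyticAt_snd.prod analyticAt_fst

/-- Division of an analytic function of two variables by the second coordinate. -/
theorem AnalyticAt.exists_div_snd {f : ℂ × ℂ → ℂ} {p : ℂ × ℂ} (hf : AnalyticAt ℂ f p) :
    ∃ k : ℂ × ℂ → ℂ, AnalyticAt ℂ k p ∧
      ∀ᶠ q in 𝓝 p, f q - f (q.1, p.2) = (q.2 - p.2) * k q := by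
  have h1 : AnalyticAt ℂ (f ∘ Prod.swap) p.swap :=
    AnalyticAt.comp (by simpa using hf) (analyticAt_swap _)
  obtain ⟨k, hk, he⟩ := h1.exists_div_fst
  refine ⟨k ∘ Prod.swap, hk.comp (analyticAt_swap _), ?_⟩
  have h2 : Tendsto Prod.swap (𝓝 p) (𝓝 p.swap) := continuous_swap.continuousAt
  exact h2.eventually he

/-- The series of a uniformly summable family of analytic functions is analytic. -/
theorem analyticOnNhd_tsum {s : Set (ℂ × ℂ)} (hs : IsOpen s) {F : ℕ → ℂ × ℂ → ℂ} {u : ℕ → ℝ}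
    (hu : Summable u) (hF : ∀ n, AnalyticOnNhd ℂ (F n) s) (hb : ∀ n, ∀ p ∈ s, ‖F n p‖ ≤ u n) :
    AnalyticOnNhd ℂ (fun p => ∑' n, F n p) s := by
  refine analyticOnNhd_of_continuousOn_of_separately hs
    (continuousOn_tsum (fun n => (hF n).continuousOn) hu hb) ?_ ?_
  · rintro ⟨x, y⟩ hp
    have ho : IsOpen ((fun x => (x, y)) ⁻¹' s) := hs.preimage (by fun_prop)
    exact (Complex.differentiableOn_tsum_of_summable_norm (F := fun n x => F n (x, y)) hu
      (fun n x hx => (AnalyticAt.slice_fst (hF n _ hx)).differentiableAt.differentiableWithinAt) ho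
      (fun n x hx => hb n _ hx)).differentiableAt (ho.mem_nhds hp)
  · rintro ⟨x, y⟩ hp
    have ho : IsOpen ((fun y => (x, y)) ⁻¹' s) := hs.preimage (by fun_prop)
    exact (Complex.differentiableOn_tsum_of_summable_norm (F := fun n y => F n (x, y)) hu
      (fun n y hy => (AnalyticAt.slice_snd (hF n _ hy)).differentiableAt.differentiableWithinAt) ho
      (fun n y hy => hb n _ hy)).differentiableAt (ho.mem_nhds hp)

/-- The standing hypotheses: `f` is meromorphic on the domain `U` and `z₀` is a simple root of `f`. -/
structure IsSimpleRootOn (f : ℂ → ℂ) (U : Set ℂ) (z₀ : ℂ) : Prop where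
  isOpen : IsOpen U
  isConnected : IsConnected U
  meromorphicOn : MeromorphicOn f U
  mem : z₀ ∈ U
  root : f z₀ = 0
  simple : deriv f z₀ ≠ 0

/-- Two functions continuous at `p` that agree near `p` off the lines `x = c` and `y = c` agree at
`p`. -/
theorem eq_of_eventually_eq_off_axes {E : Type*} [TopologicalSpace E] [T2Space E] {c : ℂ}
    {p : ℂ × ℂ} {u v : ℂ × ℂ → E} (hu : ContinuousAt u p) (hv : ContinuousAt v p)
    (h : ∀ᶠ q in 𝓝 p, q.1 ≠ c → q.2 ≠ c → u q = v q) : u p = v p := by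
  have hd : Dense (({c}ᶜ : Set ℂ) ×ˢ ({c}ᶜ : Set ℂ)) :=
    (dense_compl_singleton c).prod (dense_compl_singleton c)
  have : (𝓝[({c}ᶜ : Set ℂ) ×ˢ ({c}ᶜ : Set ℂ)] p).NeBot := mem_closure_iff_nhdsWithin_neBot.1 (hd p)
  refine tendsto_nhds_unique_of_eventuallyEq
    (hu.mono_left (nhdsWithin_le_nhds (s := ({c}ᶜ : Set ℂ) ×ˢ ({c}ᶜ : Set ℂ))))
    (hv.mono_left nhdsWithin_le_nhds) ?_
  rw [EventuallyEq, eventually_nhdsWithin_iff]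
  filter_upwards [h] with q hq hqm using hq hqm.1 hqm.2

/-- An analytic function that vanishes on the lines `x = c` and `y = c` is divisible by
`(x - c) (y - c)`. -/
theorem AnalyticAt.exists_factor_axes {h : ℂ × ℂ → ℂ} {p : ℂ × ℂ} (hh : AnalyticAt ℂ h p) {c : ℂ}
    (h₁ : ∀ᶠ q in 𝓝 p, q.1 = c → h q = 0) (h₂ : ∀ᶠ q in 𝓝 p, q.2 = c → h q = 0) :
    ∃ k : ℂ × ℂ → ℂ, AnalyticAt ℂ k p ∧ ∀ᶠ q in 𝓝 p, h q = k q * (q.1 - c) * (q.2 - c) := by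
  have step : ∃ k : ℂ × ℂ → ℂ, AnalyticAt ℂ k p ∧ ∀ᶠ q in 𝓝 p, h q = (q.1 - c) * k q := by
    by_cases hp : p.1 = c
    · obtain ⟨k, hk, he⟩ := hh.exists_div_fst
      refine ⟨k, hk, ?_⟩
      have ht : Tendsto (fun q : ℂ × ℂ => (p.1, q.2)) (𝓝 p) (𝓝 p) := by
        have : ContinuousAt (fun q : ℂ × ℂ => (p.1, q.2)) p := by fun_prop
        simpa using this.tendsto
      filter_upwards [he, ht.eventually h₁] with q hq hq'
      rw [hq' hp, sub_zero, hp] at hq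
      exact hq
    · have hne : p.1 - c ≠ 0 := sub_ne_zero.2 hp
      have ha : AnalyticAt ℂ (fun q : ℂ × ℂ => q.1 - c) p := analyticAt_fst.sub analyticAt_const
      refine ⟨fun q => h q / (q.1 - c), hh.div ha hne, ?_⟩
      filter_upwards [ha.continuousAt.eventually_ne hne] with q hq
      field_simp
  obtain ⟨k₁, hk₁, he₁⟩ := step
  by_cases hp : p.2 = c
  · obtain ⟨k, hk, he⟩ := hk₁.exists_div_snd
    refine ⟨k, hk, ?_⟩
    have ht : Tendsto (fun q : ℂ × ℂ => (q.1, p.2)) (𝓝 p) (𝓝 p) := by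
      have : ContinuousAt (fun q : ℂ × ℂ => (q.1, p.2)) p := by fun_prop
      simpa using this.tendsto
    -- `k₁` need not be shown to vanish on y = c: only (x - c)·k₁(x, c) = 0 is used.
    filter_upwards [he, he₁, ht.eventually h₂, ht.eventually he₁] with q hq hq₁ hq₂ hq₃
    rw [hq₂ hp] at hq₃
    rw [hp] at hq hq₃
    rw [hq₁]
    linear_combination (q.1 - c) * hq - hq₃
  · have hne : p.2 - c ≠ 0 := sub_ne_zero.2 hp
    have ha : AnalyticAt ℂ (fun q : ℂ × ℂ => q.2 - c) p := analyticAt_snd.sub analyticAt_const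
    refine ⟨fun q => k₁ q / (q.2 - c), hk₁.div ha hne, ?_⟩
    filter_upwards [ha.continuousAt.eventually_ne hne, he₁] with q hq hq₁
    rw [hq₁]
    field_simp

/-- The divided difference of an analytic function extends analytically over the diagonal. -/
theorem AnalyticAt.exists_dividedDifference {f : ℂ → ℂ} {c : ℂ} (hf : AnalyticAt ℂ f c) :
    ∃ D : ℂ × ℂ → ℂ, AnalyticAt ℂ D (c, c) ∧ D (c, c) = deriv f c ∧
      ∀ᶠ q in 𝓝 (c, c), f q.1 - f q.2 = (q.1 - q.2) * D q := by
  -- Division by u of f(u + y) - f(y) at u = 0, followed by u = x - y, gives the divided difference.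
  have hF : AnalyticAt ℂ (fun q : ℂ × ℂ => f (q.1 + q.2)) (0, c) :=
    AnalyticAt.comp (f := fun q : ℂ × ℂ => q.1 + q.2) (g := f) (by simpa using hf)
      (analyticAt_fst.add analyticAt_snd)
  obtain ⟨k, hk, he⟩ := hF.exists_div_fst
  have hm : AnalyticAt ℂ (fun q : ℂ × ℂ => (q.1 - q.2, q.2)) (c, c) :=
    (analyticAt_fst.sub analyticAt_snd).prod analyticAt_snd
  have ht : Tendsto (fun q : ℂ × ℂ => (q.1 - q.2, q.2)) (𝓝 (c, c)) (𝓝 (0, c)) := by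
    simpa using hm.continuousAt.tendsto
  have hD : AnalyticAt ℂ (fun q : ℂ × ℂ => k (q.1 - q.2, q.2)) (c, c) :=
    AnalyticAt.comp (f := fun q : ℂ × ℂ => (q.1 - q.2, q.2)) (g := k) (by simpa using hk) hm
  have hE : ∀ᶠ q in 𝓝 (c, c), f q.1 - f q.2 = (q.1 - q.2) * k (q.1 - q.2, q.2) := by
    filter_upwards [ht.eventually he] with q hq
    simpa using hq
  refine ⟨_, hD, ?_, hE⟩
  have h1 : Tendsto (slope f c) (𝓝[≠] c) (𝓝 (deriv f c)) :=
    hasDerivAt_iff_tendsto_slope.1 hf.differentiableAt.hasDerivAt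
  have h2 : Tendsto (fun x => k (x - c, c)) (𝓝[≠] c) (𝓝 (k (c - c, c))) :=
    (AnalyticAt.slice_fst hD).continuousAt.tendsto.mono_left nhdsWithin_le_nhds
  refine tendsto_nhds_unique h2 (h1.congr' ?_)
  have h3 : Tendsto (fun x : ℂ => (x, c)) (𝓝 c) (𝓝 (c, c)) :=
    Continuous.tendsto (by fun_prop) c
  filter_upwards [nhdsWithin_le_nhds (h3.eventually hE), self_mem_nhdsWithin] with x hx hxc
  have : x - c ≠ 0 := sub_ne_zero.2 hxc
  rw [slope_def_field, hx]
  field_simp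

/-! ### The secant map on its domain and its normal form -/

namespace IsSimpleRootOn

variable {f : ℂ → ℂ} {U : Set ℂ} {z₀ : ℂ}

theorem analyticAt (h : IsSimpleRootOn f U z₀) : AnalyticAt ℂ f z₀ :=
  (h.meromorphicOn z₀ h.mem).analyticAt (differentiableAt_of_deriv_ne_zero h.simple).continuousAt

/-- Identity theorem: f - c has finite order at z₀, since otherwise f would be constant near z₀
against f'(z₀) ≠ 0. Finiteness of the order propagates over the connected set U. -/
theorem eventually_ne (h : IsSimpleRootOn f U z₀) {b : ℂ} (hb : b ∈ U) (c : ℂ) :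
    ∀ᶠ y in 𝓝[≠] b, f y ≠ c := by
  have hm : MeromorphicOn (fun z => f z - c) U := fun z hz =>
    (h.meromorphicOn z hz).sub (MeromorphicAt.const c z)
  have hz : meromorphicOrderAt (fun z => f z - c) z₀ ≠ ⊤ := by
    rw [Ne, meromorphicOrderAt_eq_top_iff]
    intro he
    have hev : ∀ᶠ z in 𝓝[≠] z₀, f z = c := by
      filter_upwards [he] with z hz using sub_eq_zero.1 hz
    have hc : f z₀ = c := by
      refine tendsto_nhds_unique 
        (h.analyticAt.continuousAt.tendsto.mono_left (nhdsWithin_le_nhds (s := {z₀}ᶜ)))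
        (tendsto_const_nhds.congr' ?_)
      filter_upwards [hev] with z hz using hz.symm
    have hev' : f =ᶠ[𝓝 z₀] fun _ => c := by
      rw [eventually_nhdsWithin_iff] at hev
      filter_upwards [hev] with z hz
      by_cases hzz : z = z₀
      · rw [hzz, hc]
      · exact hz hzz
    exact h.simple (by rw [hev'.deriv_eq, deriv_const])
  have hb' := hm.meromorphicOrderAt_ne_top_of_isPreconnected h.isConnected.isPreconnected
    h.mem hb hz
  rw [meromorphicOrderAt_ne_top_iff_eventually_ne_zero (hm b hb)] at hb'
  filter_upwards [hb'] with y hy hyc using hy (sub_eq_zero.2 hyc)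

/-- This makes the limit in `secantMap` unique: pairs with both entries off the poles and with
distinct values of f accumulate at every point of U × U. -/
theorem neBot_nhdsWithin_secantRegular (h : IsSimpleRootOn f U z₀) {p : ℂ × ℂ} (h₁ : p.1 ∈ U)
    (h₂ : p.2 ∈ U) : (𝓝[secantRegular f] p).NeBot := by
  rw [← mem_closure_iff_nhdsWithin_neBot, mem_closure_iff_nhds]
  intro t ht
  obtain ⟨a, b⟩ := p
  rw [nhds_prod_eq] at ht
  obtain ⟨u, hu, v, hv, huv⟩ := mem_prod_iff.1 ht
  obtain ⟨x, hxu, hx⟩ := ((eventually_nhdsWithin_of_eventually_nhds (s := {a}ᶜ) (eventually_mem_set.2 hu)).and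
    (h.meromorphicOn a h₁).eventually_analyticAt).exists
  obtain ⟨y, ⟨hyv, hy⟩, hyx⟩ := (((eventually_nhdsWithin_of_eventually_nhds (s := {b}ᶜ) (eventually_mem_set.2 hv)).and
    (h.meromorphicOn b h₂).eventually_analyticAt).and (h.eventually_ne h₂ (f x))).exists
  exact ⟨(x, y), huv ⟨hxu, hyv⟩, hx, hy, hyx.symm⟩

/-- Near a point of its domain, the secant map is given by an analytic extension of the secant
expression. -/
theorem exists_secantMap_eq (h : IsSimpleRootOn f U z₀) {p : ℂ × ℂ} (hp : p ∈ secantDomain f U) :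
    ∃ s : ℂ × ℂ → ℂ, AnalyticAt ℂ s p ∧
      (∀ᶠ q in 𝓝 p, q ∈ secantRegular f → s q = secantQuotient f q) ∧
      ∀ᶠ q in 𝓝 p, q ∈ secantDomain f U ∧ secantMap f q = (s q, q.1) := by
  obtain ⟨h₁, h₂, s, hs, hsq⟩ := hp
  refine ⟨s, hs, hsq, ?_⟩
  have hU₁ : ∀ᶠ q : ℂ × ℂ in 𝓝 p, q.1 ∈ U :=
    continuousAt_fst.eventually (h.isOpen.mem_nhds h₁)
  have hU₂ : ∀ᶠ q : ℂ × ℂ in 𝓝 p, q.2 ∈ U :=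
    continuousAt_snd.eventually (h.isOpen.mem_nhds h₂)
  filter_upwards [hU₁, hU₂, hs.eventually_analyticAt, eventually_eventually_nhds.2 hsq]
    with q hq₁ hq₂ hsa hsq'
  refine ⟨⟨hq₁, hq₂, s, hsa, hsq'⟩, ?_⟩
  have := h.neBot_nhdsWithin_secantRegular hq₁ hq₂
  have ht : Tendsto (secantQuotient f) (𝓝[secantRegular f] q) (𝓝 (s q)) := by
    refine (hsa.continuousAt.tendsto.mono_left nhdsWithin_le_nhds).congr' ?_
    exact eventually_nhdsWithin_iff.2 hsq'
  rw [secantMap, ht.limUnder_eq]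

theorem isOpen_secantDomain (h : IsSimpleRootOn f U z₀) : IsOpen (secantDomain f U) := by
  rw [isOpen_iff_mem_nhds]
  intro p hp
  obtain ⟨s, -, -, he⟩ := h.exists_secantMap_eq hp
  filter_upwards [he] with q hq using hq.1

theorem analyticAt_secantMap (h : IsSimpleRootOn f U z₀) {p : ℂ × ℂ} (hp : p ∈ secantDomain f U) :
    AnalyticAt ℂ (secantMap f) p := by
  obtain ⟨s, hs, -, he⟩ := h.exists_secantMap_eq hp
  refine (hs.prod analyticAt_fst).congr ?_
  filter_upwards [he] with q hq using hq.2.symm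

/-- With f(x) = 0 the expression is (-f(y) z₀)/(-f(y)). Nearby points of the same vertical line with
f(y) ≠ 0 are regular, and continuity of the extension does the rest. -/
theorem secantMap_fst_of_fst_eq (h : IsSimpleRootOn f U z₀) {p : ℂ × ℂ}
    (hp : p ∈ secantDomain f U) (hz : p.1 = z₀) : (secantMap f p).1 = z₀ := by
  obtain ⟨s, hs, hsq, he⟩ := h.exists_secantMap_eq hp
  rw [he.self_of_nhds.2]
  have ht : Tendsto (fun y => (p.1, y)) (𝓝[≠] p.2) (𝓝 p) := by
    have : ContinuousAt (fun y => (p.1, y)) p.2 := by fun_prop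
    exact this.tendsto.mono_left nhdsWithin_le_nhds
  refine tendsto_nhds_unique (hs.continuousAt.tendsto.comp ht) (tendsto_const_nhds.congr' ?_)
  filter_upwards [ht.eventually hsq, h.eventually_ne hp.2.1 0,
    (h.meromorphicOn _ hp.2.1).eventually_analyticAt] with y hy hy0 hya
  rw [Function.comp_apply, hy ⟨by simpa [hz] using h.analyticAt, hya, by
    simpa [hz, h.root] using hy0.symm⟩]
  simp only [secantQuotient, hz, h.root]
  field_simp
  ring

theorem secantMap_fst_of_snd_eq (h : IsSimpleRootOn f U z₀) {p : ℂ × ℂ}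
    (hp : p ∈ secantDomain f U) (hz : p.2 = z₀) : (secantMap f p).1 = z₀ := by
  obtain ⟨s, hs, hsq, he⟩ := h.exists_secantMap_eq hp
  rw [he.self_of_nhds.2]
  have ht : Tendsto (fun x => (x, p.2)) (𝓝[≠] p.1) (𝓝 p) := by
    have : ContinuousAt (fun x => (x, p.2)) p.1 := by fun_prop
    exact this.tendsto.mono_left nhdsWithin_le_nhds
  refine tendsto_nhds_unique (hs.continuousAt.tendsto.comp ht) (tendsto_const_nhds.congr' ?_)
  filter_upwards [ht.eventually hsq, h.eventually_ne hp.1 0,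
    (h.meromorphicOn _ hp.1).eventually_analyticAt] with x hx hx0 hxa
  rw [Function.comp_apply, hx ⟨hxa, by simpa [hz] using h.analyticAt, by
    simpa [hz, h.root] using hx0⟩]
  simp only [secantQuotient, hz, h.root]
  field_simp
  ring

/-- The extension is x - f(x)/D(x, y) with D the divided difference, whose value f'(z₀) at the fixed
point is nonzero. -/
theorem mem_secantDomain (h : IsSimpleRootOn f U z₀) : (z₀, z₀) ∈ secantDomain f U := by
  obtain ⟨D, hD, hDz, he⟩ := h.analyticAt.exists_dividedDifference
  have hne : D (z₀, z₀) ≠ 0 := by rw [hDz]; exact h.simple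
  have hf₁ : AnalyticAt ℂ (fun q : ℂ × ℂ => f q.1) (z₀, z₀) :=
    AnalyticAt.comp (f := Prod.fst) (g := f) (x := (z₀, z₀)) h.analyticAt analyticAt_fst
  refine ⟨h.mem, h.mem, fun q => q.1 - f q.1 / D q, analyticAt_fst.sub (hf₁.div hD hne), ?_⟩
  filter_upwards [he, hD.continuousAt.eventually_ne hne] with q hq hDq hr
  have h1 : f q.1 - f q.2 ≠ 0 := sub_ne_zero.2 hr.2.2
  have h2 : q.1 - q.2 ≠ 0 := by
    intro h0
    rw [hq, h0, zero_mul] at h1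
    exact h1 rfl
  rw [secantQuotient, eq_div_iff h1, sub_mul, div_mul_eq_mul_div]
  have h3 : f q.1 * (f q.1 - f q.2) / D q = f q.1 * (q.1 - q.2) := by
    rw [hq]
    field_simp
  rw [h3]
  ring

/-- On its domain the secant map has the form `(z₀ + G (x, y) (x - z₀) (y - z₀), x)` with `G`
holomorphic. -/
theorem exists_secantFactor (h : IsSimpleRootOn f U z₀) :
    ∃ G : ℂ × ℂ → ℂ, AnalyticOnNhd ℂ G (secantDomain f U) ∧
      ∀ p ∈ secantDomain f U,
        secantMap f p = (z₀ + G p * (p.1 - z₀) * (p.2 - z₀), p.1) := by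
  have hloc : ∀ p ∈ secantDomain f U, ∃ k : ℂ × ℂ → ℂ, AnalyticAt ℂ k p ∧
      ∀ᶠ q in 𝓝 p, (secantMap f q).1 - z₀ = k q * (q.1 - z₀) * (q.2 - z₀) := by
    intro p hp
    refine AnalyticAt.exists_factor_axes ?_ ?_ ?_
    · exact ((analyticAt_fst (p := secantMap f p)).comp (h.analyticAt_secantMap hp)).sub
        analyticAt_const
    · filter_upwards [h.isOpen_secantDomain.mem_nhds hp] with q hq hqz
      rw [h.secantMap_fst_of_fst_eq hq hqz, sub_self]
    · filter_upwards [h.isOpen_secantDomain.mem_nhds hp] with q hq hqz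
      rw [h.secantMap_fst_of_snd_eq hq hqz, sub_self]
  choose! k hk hke using hloc
  -- The local factors agree off the axes, hence everywhere by continuity, so near p the glued
  -- function coincides with `k p`.
  refine ⟨fun p => k p p, fun p hp => (hk p hp).congr ?_, fun p hp => ?_⟩
  · filter_upwards [h.isOpen_secantDomain.mem_nhds hp, (hk p hp).eventually_analyticAt,
      eventually_eventually_nhds.2 (hke p hp)] with q hq hkq heq
    refine eq_of_eventually_eq_off_axes (c := z₀) hkq.continuousAt (hk q hq).continuousAt ?_
    filter_upwards [heq, hke q hq] with r hr₁ hr₂ h₁ h₂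
    rw [hr₁] at hr₂
    exact mul_right_cancel₀ (sub_ne_zero.2 h₁) (mul_right_cancel₀ (sub_ne_zero.2 h₂) hr₂)
  · refine Prod.ext ?_ rfl
    rw [← (hke p hp).self_of_nhds]
    ring

end IsSimpleRootOn

/-! ### The value of G at the fixed point -/

/-- The derivative at a root of the quotient of `f` by `x - c`. -/
theorem AnalyticAt.deriv_dslope_self {f : ℂ → ℂ} {c : ℂ} (hf : AnalyticAt ℂ f c) :
    AnalyticAt ℂ (dslope f c) c ∧ deriv (dslope f c) c = deriv (deriv f) c / 2 := by
  obtain ⟨p, hp⟩ := hf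
  have hg : AnalyticAt ℂ (dslope f c) c := ⟨_, hp.has_fpower_series_dslope_fslope⟩
  refine ⟨hg, ?_⟩
  have hfe : f = fun x => f c + (x - c) * dslope f c x := by
    ext x
    have := sub_smul_dslope f c x
    rw [smul_eq_mul] at this
    rw [this]
    ring
  -- With f = f(c) + (x - c)g, differentiating twice at c gives f'' = 2g'.
  have hd : deriv f =ᶠ[𝓝 c] fun x => dslope f c x + (x - c) * deriv (dslope f c) x := by
    filter_upwards [hg.eventually_analyticAt] with x hx
    have h1 : HasDerivAt (fun x => f c + (x - c) * dslope f c x)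
        (1 * dslope f c x + (x - c) * deriv (dslope f c) x) x :=
      (((hasDerivAt_id x).sub_const c).mul hx.differentiableAt.hasDerivAt).const_add _
    rw [← hfe] at h1
    rw [h1.deriv, one_mul]
  have h2 : HasDerivAt (fun x => dslope f c x + (x - c) * deriv (dslope f c) x)
      (deriv (dslope f c) c + (1 * deriv (dslope f c) c + (c - c) * deriv (deriv (dslope f c)) c))
      c :=
    hg.differentiableAt.hasDerivAt.add
      (((hasDerivAt_id c).sub_const c).mul hg.deriv.differentiableAt.hasDerivAt)
  rw [hd.deriv_eq, h2.deriv]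
  ring

namespace IsSimpleRootOn

variable {f : ℂ → ℂ} {U : Set ℂ} {z₀ : ℂ}

/-- The value at `(z₀, z₀)` of the factor in the normal form of the secant map. -/
theorem secantFactor_apply (h : IsSimpleRootOn f U z₀) {G : ℂ × ℂ → ℂ}
    (hG : AnalyticAt ℂ G (z₀, z₀))
    (hS : ∀ᶠ q in 𝓝 (z₀, z₀), secantMap f q = (z₀ + G q * (q.1 - z₀) * (q.2 - z₀), q.1)) :
    G (z₀, z₀) = deriv (deriv f) z₀ / (2 * deriv f z₀) := by
  obtain ⟨hg, hg'⟩ := h.analyticAt.deriv_dslope_self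
  set g := dslope f z₀ with hgdef
  have hfg : ∀ x, f x = (x - z₀) * g x := by
    intro x
    have := sub_smul_dslope f z₀ x
    rw [smul_eq_mul, h.root, sub_zero] at this
    exact this.symm
  have hgz : g z₀ = deriv f z₀ := dslope_same f z₀
  obtain ⟨D, hD, hDz, hDe⟩ := h.analyticAt.exists_dividedDifference
  have hDne : D (z₀, z₀) ≠ 0 := by rw [hDz]; exact h.simple
  obtain ⟨s, hs, hsq, hse⟩ := h.exists_secantMap_eq h.mem_secantDomain
  have ht₁ : Tendsto (Prod.fst : ℂ × ℂ → ℂ) (𝓝 (z₀, z₀)) (𝓝 z₀) := continuousAt_fst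
  have ht₂ : Tendsto (Prod.snd : ℂ × ℂ → ℂ) (𝓝 (z₀, z₀)) (𝓝 z₀) := continuousAt_snd
  -- For f = (x - z₀)g, the secant expression minus z₀ is (x - z₀)(y - z₀)(g(x) - g(y))/(f(x) -
  -- f(y)).
  have hoff : ∀ᶠ q in 𝓝 (z₀, z₀), q.1 ≠ z₀ → q.2 ≠ z₀ →
      G q * (f q.1 - f q.2) = g q.1 - g q.2 := by
    filter_upwards [hS, hDe, hD.continuousAt.eventually_ne hDne, hsq, hse,
      ht₁.eventually h.analyticAt.eventually_analyticAt,
      ht₂.eventually h.analyticAt.eventually_analyticAt] with q hSq hDq hDq0 hsq hse ha₁ ha₂ h₁ h₂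
    by_cases hq : q.1 = q.2
    · rw [hq]; ring
    have hne : f q.1 - f q.2 ≠ 0 := by
      rw [hDq]; exact mul_ne_zero (sub_ne_zero.2 hq) hDq0
    have h3 := hsq ⟨ha₁, ha₂, sub_ne_zero.1 hne⟩
    have h4 : s q = z₀ + G q * (q.1 - z₀) * (q.2 - z₀) :=
      congrArg Prod.fst (hse.2.symm.trans hSq)
    rw [h4, secantQuotient, eq_div_iff hne] at h3
    refine mul_left_cancel₀ (sub_ne_zero.2 h₁) (mul_left_cancel₀ (sub_ne_zero.2 h₂) ?_)
    have e₁ := hfg q.1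
    have e₂ := hfg q.2
    linear_combination h3 + (q.2 - z₀) * e₁ - (q.1 - z₀) * e₂
  -- Continuity permits y = z₀. Dividing by x - z₀ and letting x tend to z₀ then yields G·g = g' at
  -- the fixed point.
  have haxis : ∀ᶠ x in 𝓝 z₀, G (x, z₀) * f x = g x - g z₀ := by
    have ht : Tendsto (fun x : ℂ => (x, z₀)) (𝓝 z₀) (𝓝 (z₀, z₀)) :=
      Continuous.tendsto (by fun_prop) z₀
    filter_upwards [ht.eventually (eventually_eventually_nhds.2 hoff),
      ht.eventually hG.eventually_analyticAt, h.analyticAt.eventually_analyticAt,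
      hg.eventually_analyticAt] with x hx hGx hfx hgx
    have hc₁ : ContinuousAt (fun q : ℂ × ℂ => f q.1) (x, z₀) :=
      ContinuousAt.comp (f := Prod.fst) (g := f) (x := (x, z₀)) hfx.continuousAt continuousAt_fst
    have hc₂ : ContinuousAt (fun q : ℂ × ℂ => f q.2) (x, z₀) :=
      ContinuousAt.comp (f := Prod.snd) (g := f) (x := (x, z₀)) h.analyticAt.continuousAt
        continuousAt_snd
    have hc₃ : ContinuousAt (fun q : ℂ × ℂ => g q.1) (x, z₀) :=
      ContinuousAt.comp (f := Prod.fst) (g := g) (x := (x, z₀)) hgx.continuousAt continuousAt_fst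
    have hc₄ : ContinuousAt (fun q : ℂ × ℂ => g q.2) (x, z₀) :=
      ContinuousAt.comp (f := Prod.snd) (g := g) (x := (x, z₀)) hg.continuousAt continuousAt_snd
    have := eq_of_eventually_eq_off_axes (hGx.continuousAt.mul (hc₁.sub hc₂)) (hc₃.sub hc₄) hx
    simpa [h.root] using this
  have hlim₁ : Tendsto (slope g z₀) (𝓝[≠] z₀) (𝓝 (deriv g z₀)) :=
    hasDerivAt_iff_tendsto_slope.1 hg.differentiableAt.hasDerivAt
  have hlim₂ : Tendsto (fun x => G (x, z₀) * g x) (𝓝[≠] z₀) (𝓝 (G (z₀, z₀) * g z₀)) :=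
    ((AnalyticAt.slice_fst hG).continuousAt.mul hg.continuousAt).tendsto.mono_left
      nhdsWithin_le_nhds
  have key : G (z₀, z₀) * g z₀ = deriv g z₀ := by
    refine tendsto_nhds_unique hlim₂ (hlim₁.congr' ?_)
    filter_upwards [nhdsWithin_le_nhds haxis, self_mem_nhdsWithin] with x hx hxz
    have hxz' : x - z₀ ≠ 0 := sub_ne_zero.2 hxz
    rw [slope_def_field, ← hx, hfg x]
    field_simp
  have hs := h.simple
  rw [hgz, hg'] at key
  rw [eq_div_iff (mul_ne_zero two_ne_zero hs)]
  linear_combination 2 * key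

/-! ### The basin: invariant neighbourhoods and openness -/

theorem secantBasin_subset : secantBasin f U z₀ ⊆ secantDomain f U := fun _ hp => hp.1 0

theorem mapsTo_secantBasin : Set.MapsTo (secantMap f) (secantBasin f U z₀) (secantBasin f U z₀) := by
  intro p hp
  refine ⟨fun n => ?_, ?_⟩
  · rw [← Function.iterate_succ_apply]
    exact hp.1 (n + 1)
  · simp_rw [← Function.iterate_succ_apply]
    exact (tendsto_add_atTop_iff_nat 1).2 hp.2

/-- The fixed point `(z₀, z₀)` has arbitrarily small forward-invariant neighbourhoods in the
basin. -/
theorem exists_mapsTo_subset_secantBasin (h : IsSimpleRootOn f U z₀) {N : Set (ℂ × ℂ)}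
    (hN : N ∈ 𝓝 (z₀, z₀)) : ∃ W, IsOpen W ∧ (z₀, z₀) ∈ W ∧ W ⊆ N ∧ W ⊆ secantBasin f U z₀ ∧
      Set.MapsTo (secantMap f) W W := by
  obtain ⟨G, hG, hS⟩ := h.exists_secantFactor
  obtain ⟨M, hM⟩ : ∃ M : ℝ, ∀ᶠ q in 𝓝 (z₀, z₀), ‖G q‖ < M :=
    ⟨‖G (z₀, z₀)‖ + 1, (hG _ h.mem_secantDomain).continuousAt.norm.eventually_lt_const
      (lt_add_one _)⟩
  obtain ⟨ε, hε, hεs⟩ := Metric.mem_nhds_iff.1 (inter_mem (inter_mem hN hM)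
    (h.isOpen_secantDomain.mem_nhds h.mem_secantDomain))
  have hM0 : 0 < M := (norm_nonneg _).trans_lt (hεs (mem_ball_self hε)).1.2
  -- With |G| < M, the bound |y - z₀| ≤ 1/(2M) makes the first coordinate contract by 1/2.
  set δ := min ε (1 / (2 * M)) with hδ
  have hδ0 : 0 < δ := lt_min hε (by positivity)
  have hsub : ball (z₀, z₀) δ ⊆ ball (z₀, z₀) ε := ball_subset_ball (min_le_left _ _)
  have hmem : ∀ q : ℂ × ℂ, q ∈ ball (z₀, z₀) δ ↔ ‖q.1 - z₀‖ < δ ∧ ‖q.2 - z₀‖ < δ := by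
    intro q
    rw [mem_ball, Prod.dist_eq, max_lt_iff, dist_eq_norm, dist_eq_norm]
  have hstep : ∀ q ∈ ball (z₀, z₀) δ, ‖(secantMap f q).1 - z₀‖ ≤ 1 / 2 * ‖q.1 - z₀‖ := by
    intro q hq
    obtain ⟨⟨-, hq₂⟩, hq₃⟩ := hεs (hsub hq)
    have hq₂ : ‖G q‖ < M := hq₂
    rw [hS q hq₃]
    have h1 : ‖q.2 - z₀‖ ≤ 1 / (2 * M) := ((hmem q).1 hq).2.le.trans (min_le_right _ _)
    calc ‖z₀ + G q * (q.1 - z₀) * (q.2 - z₀) - z₀‖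
        = ‖G q‖ * ‖q.1 - z₀‖ * ‖q.2 - z₀‖ := by
          rw [add_sub_cancel_left, norm_mul, norm_mul]
      _ ≤ M * ‖q.1 - z₀‖ * (1 / (2 * M)) := by gcongr
      _ = 1 / 2 * ‖q.1 - z₀‖ := by field_simp
  have hinv : Set.MapsTo (secantMap f) (ball (z₀, z₀) δ) (ball (z₀, z₀) δ) := by
    intro q hq
    have h1 := (hmem q).1 hq
    refine (hmem _).2 ⟨?_, h1.1⟩
    linarith [hstep q hq, norm_nonneg (q.1 - z₀)]
  refine ⟨ball (z₀, z₀) δ, isOpen_ball, mem_ball_self hδ0, fun q hq => (hεs (hsub hq)).1.1, ?_,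
    hinv⟩
  intro p hp
  have hit : ∀ n, (secantMap f)^[n] p ∈ ball (z₀, z₀) δ := fun n => hinv.iterate n hp
  refine ⟨fun n => (hεs (hsub (hit n))).2, ?_⟩
  have hbd : ∀ n : ℕ, ‖((secantMap f)^[n] p).1 - z₀‖ ≤ (1 / 2) ^ n * δ := by
    intro n
    induction n with
    | zero => simpa using ((hmem p).1 hp).1.le
    | succ n ih =>
      rw [Function.iterate_succ_apply']
      calc _ ≤ 1 / 2 * ‖((secantMap f)^[n] p).1 - z₀‖ := hstep _ (hit n)
        _ ≤ 1 / 2 * ((1 / 2) ^ n * δ) := by gcongr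
        _ = _ := by ring
  have hfst : Tendsto (fun n => ((secantMap f)^[n] p).1) atTop (𝓝 z₀) := by
    rw [tendsto_iff_norm_sub_tendsto_zero]
    refine squeeze_zero (fun _ => norm_nonneg _) hbd ?_
    simpa using (tendsto_pow_atTop_nhds_zero_of_lt_one (by norm_num : (0 : ℝ) ≤ 1 / 2)
      (by norm_num)).mul_const δ
  refine Tendsto.prodMk_nhds hfst ?_
  rw [← tendsto_add_atTop_iff_nat 1]
  refine hfst.congr fun n => ?_
  rw [Function.iterate_succ_apply']
  rfl

theorem analyticAt_iterate_secantMap (h : IsSimpleRootOn f U z₀) {p : ℂ × ℂ}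
    (hp : p ∈ secantBasin f U z₀) (n : ℕ) : AnalyticAt ℂ (secantMap f)^[n] p := by
  induction n with
  | zero => exact analyticAt_id
  | succ n ih =>
    rw [Function.iterate_succ']
    exact (h.analyticAt_secantMap (hp.1 n)).comp ih

/-- Once an orbit enters an invariant neighbourhood inside the basin, only the finitely many earlier
iterates impose conditions, all of them open. -/
theorem isOpen_secantBasin (h : IsSimpleRootOn f U z₀) : IsOpen (secantBasin f U z₀) := by
  obtain ⟨W, hWo, hW, -, hWs, -⟩ := h.exists_mapsTo_subset_secantBasin univ_mem
  rw [isOpen_iff_mem_nhds]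
  intro p hp
  obtain ⟨N, hN⟩ := (hp.2.eventually (hWo.mem_nhds hW)).exists
  have h1 : ∀ᶠ q in 𝓝 p, ∀ n ∈ Finset.range N, (secantMap f)^[n] q ∈ secantDomain f U := by
    rw [eventually_all_finset]
    exact fun n _ => (h.analyticAt_iterate_secantMap hp n).continuousAt.eventually
      (h.isOpen_secantDomain.mem_nhds (hp.1 n))
  have h2 : ∀ᶠ q in 𝓝 p, (secantMap f)^[N] q ∈ W :=
    (h.analyticAt_iterate_secantMap hp N).continuousAt.eventually (hWo.mem_nhds hN)
  filter_upwards [h1, h2] with q hq₁ hq₂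
  have hb := hWs hq₂
  refine ⟨fun n => ?_, ?_⟩
  · rcases lt_or_ge n N with hn | hn
    · exact hq₁ n (Finset.mem_range.2 hn)
    · have := hb.1 (n - N)
      rwa [← Function.iterate_add_apply, Nat.sub_add_cancel hn] at this
  · rw [← tendsto_add_atTop_iff_nat N]
    simp_rw [Function.iterate_add_apply]
    exact hb.2

end IsSimpleRootOn

/-! ### The perturbed Fibonacci recursion -/

section GoldenRecursion

open Real

theorem inv_goldenRatio_lt_one : goldenRatio⁻¹ < 1 := inv_lt_one_of_one_lt₀ one_lt_goldenRatio

theorem inv_goldenRatio_pos : 0 < goldenRatio⁻¹ := inv_pos.2 goldenRatio_pos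

theorem summable_goldenWeight : Summable fun k : ℕ => goldenRatio⁻¹ ^ k / √5 :=
  (summable_geometric_of_lt_one inv_goldenRatio_pos.le inv_goldenRatio_lt_one).div_const _

theorem goldenRatio_add_inv : goldenRatio + goldenRatio⁻¹ = √5 := by
  rw [inv_goldenRatio, ← sub_eq_add_neg, goldenRatio_sub_goldenConj]

theorem inv_goldenRatio_eq_sub_one : goldenRatio⁻¹ = goldenRatio - 1 := by
  rw [inv_goldenRatio]
  linarith [goldenRatio_add_goldenConj]

/-- The sum is φ²/√5. It is the exponent of exp(w₀) in H(z₀, z₀), where all factors of the product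
coincide. -/
theorem tsum_goldenWeight : ∑' k : ℕ, goldenRatio⁻¹ ^ k / √5 = (5 + 3 * √5) / 10 := by
  have h5 : √5 ^ 2 = (5 : ℝ) := Real.sq_sqrt (by norm_num)
  have h5p : (0 : ℝ) < √5 := Real.sqrt_pos.2 (by norm_num)
  have hφ : (1 - goldenRatio⁻¹)⁻¹ = goldenRatio ^ 2 := by
    rw [inv_eq_iff_eq_inv, ← inv_pow, inv_goldenRatio_eq_sub_one]
    linarith [goldenRatio_sq]
  rw [tsum_div_const, tsum_geometric_of_lt_one inv_goldenRatio_pos.le inv_goldenRatio_lt_one, hφ,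
    goldenRatio]
  field_simp
  linear_combination -2 * h5

/-- A bounded perturbation of the Fibonacci recursion grows like `φ ^ n`, with an explicit rate. -/
theorem tendsto_div_goldenRatio_pow {u γ : ℕ → ℝ} {B : ℝ} (hγ : ∀ n, |γ n| ≤ B)
    (hu : ∀ n, u (n + 2) = u (n + 1) + u n + γ n) :
    Tendsto (fun n => u (n + 1) / goldenRatio ^ n) atTop
      (𝓝 (goldenRatio / √5 * u 1 + 1 / √5 * u 0 + ∑' k, goldenRatio⁻¹ ^ k / √5 * γ k)) := by
  have hφ0 := goldenRatio_ne_zero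
  have hφp := goldenRatio_pos
  have hsq := goldenRatio_sq
  have h5p : (0 : ℝ) < √5 := Real.sqrt_pos.2 (by norm_num)
  have hB : 0 ≤ B := (abs_nonneg _).trans (hγ 0)
  have hsum : Summable fun k => goldenRatio⁻¹ ^ k / √5 * γ k := by
    refine Summable.of_norm_bounded (summable_goldenWeight.mul_right B) fun k => ?_
    rw [norm_mul, Real.norm_eq_abs (γ k), Real.norm_of_nonneg (by positivity)]
    gcongr
    exact hγ k
  have hinv := inv_goldenRatio_eq_sub_one
  have hadd := goldenRatio_add_inv
  have hilt := inv_goldenRatio_lt_one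
  have hipos := inv_goldenRatio_pos
  generalize goldenRatio = φ at *
  -- u (n+1) + φ⁻¹ u n is the eigencombination for φ: each step multiplies it by φ and adds γ n.
  have hv : ∀ n, φ / √5 * ((u (n + 1) + φ⁻¹ * u n) / φ ^ n) =
      φ / √5 * u 1 + 1 / √5 * u 0 +
        ∑ k ∈ Finset.range n, φ⁻¹ ^ k / √5 * γ k := by
    intro n
    induction n with
    | zero =>
      simp only [zero_add, pow_zero, div_one, Finset.range_zero, Finset.sum_empty, add_zero]
      field_simp
    | succ n ih =>
      rw [Finset.sum_range_succ, ← add_assoc, ← ih, hu n, inv_pow]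
      field_simp
      linear_combination -(u (n + 1) * φ ^ n) * hsq
  -- The eigencombination for -φ⁻¹ stays bounded; C = Bφ² solves φ⁻¹C + B = C.
  have hw : ∀ n, |u (n + 1) - φ * u n| ≤
      |u 1 - φ * u 0| + B * φ ^ 2 := by
    intro n
    induction n with
    | zero => simp only [zero_add]; nlinarith [sq_nonneg φ]
    | succ n ih =>
      have h1 : u (n + 2) - φ * u (n + 1) =
          -φ⁻¹ * (u (n + 1) - φ * u n) + γ n := by
        rw [hu n, hinv]
        linear_combination -u n * hsq
      rw [h1]
      calc _ ≤ |-φ⁻¹ * (u (n + 1) - φ * u n)| + |γ n| := abs_add_le _ _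
        _ ≤ φ⁻¹ * (|u 1 - φ * u 0| + B * φ ^ 2) + B := by
          rw [abs_mul, abs_neg, abs_of_pos hipos]
          gcongr
          exact hγ n
        _ ≤ 1 * |u 1 - φ * u 0| + (φ⁻¹ * (B * φ ^ 2) + B) := by
          rw [mul_add, add_assoc]
          gcongr
        _ = _ := by
          rw [one_mul]
          field_simp
          rw [hsq]
          ring
  have hw0 : Tendsto (fun n => (u (n + 1) - φ * u n) / φ ^ n) atTop (𝓝 0) := by
    have ht := (tendsto_pow_atTop_nhds_zero_of_lt_one hipos.le
      hilt).const_mul (|u 1 - φ * u 0| + B * φ ^ 2)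
    rw [mul_zero] at ht
    refine squeeze_zero_norm (fun n => ?_) ht
    rw [norm_div, Real.norm_eq_abs, Real.norm_of_nonneg (by positivity), inv_pow, div_eq_mul_inv]
    gcongr
    exact hw n
  -- Weights φ/√5 and φ⁻¹/√5 recover u (n+1) from the two combinations, as φ + φ⁻¹ = √5.
  have ht := (hsum.hasSum.tendsto_sum_nat.const_add
    (φ / √5 * u 1 + 1 / √5 * u 0)).add (hw0.const_mul (φ⁻¹ / √5))
  rw [mul_zero, add_zero] at ht
  refine ht.congr fun n => ?_
  rw [← hv n, ← hadd]
  have : φ + φ⁻¹ ≠ 0 := by positivity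
  field_simp
  ring

/-- The infinite product `∏ (g k) ^ (φ ^ (-k) / √5)`. -/
noncomputable def goldenProd (g : ℕ → ℝ) : ℝ :=
  -- Since `log 0 = 0`, the exponential alone would overlook a vanishing factor.
  open Classical in
  if ∀ k, g k ≠ 0 then exp (∑' k, goldenRatio⁻¹ ^ k / √5 * log (g k)) else 0

theorem exists_abs_log_le {g : ℕ → ℝ} {c : ℝ} (hc : 0 < c) (hg : Tendsto g atTop (𝓝 c)) :
    ∃ B, ∀ n, |log (g n)| ≤ B := by
  have h := ((Real.continuousAt_log hc.ne').tendsto.comp hg).norm.bddAbove_range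
  obtain ⟨B, hB⟩ := h
  exact ⟨B, fun n => hB ⟨n, rfl⟩⟩

/-- Without the factor k = 0, the remaining exponents are φ⁻¹ times those of the shifted product.
Vanishing factors cause no exception because both outer exponents are nonzero. -/
theorem goldenProd_eq {g : ℕ → ℝ} {c : ℝ} (hc : 0 < c) (hg : Tendsto g atTop (𝓝 c))
    (hg0 : ∀ n, 0 ≤ g n) :
    goldenProd g = goldenProd (fun n => g (n + 1)) ^ (1 / goldenRatio) * g 0 ^ (1 / √5) := by
  have h5p : (0 : ℝ) < √5 := Real.sqrt_pos.2 (by norm_num)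
  have e₁ : 1 / goldenRatio ≠ 0 := one_div_ne_zero goldenRatio_ne_zero
  have e₂ : 1 / √5 ≠ 0 := one_div_ne_zero h5p.ne'
  by_cases h0 : g 0 = 0
  · rw [h0, zero_rpow e₂, mul_zero, goldenProd, if_neg fun h => h 0 h0]
  by_cases h1 : ∀ k, g (k + 1) ≠ 0
  · have hall : ∀ k, g k ≠ 0 := fun k => by
      cases k with
      | zero => exact h0
      | succ k => exact h1 k
    rw [goldenProd, if_pos hall, goldenProd, if_pos h1, ← exp_mul,
      rpow_def_of_pos ((hg0 0).lt_of_ne' h0), ← exp_add]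
    obtain ⟨B, hB⟩ := exists_abs_log_le hc hg
    have hsum : Summable fun k => goldenRatio⁻¹ ^ k / √5 * log (g k) := by
      refine Summable.of_norm_bounded (summable_goldenWeight.mul_right B) fun k => ?_
      rw [norm_mul, Real.norm_of_nonneg (div_nonneg (pow_nonneg inv_goldenRatio_pos.le _) h5p.le)]
      exact mul_le_mul_of_nonneg_left (hB k)
        (div_nonneg (pow_nonneg inv_goldenRatio_pos.le _) h5p.le)
    rw [hsum.tsum_eq_zero_add, ← tsum_mul_right, add_comm]
    congr 2
    · refine tsum_congr fun k => ?_
      rw [pow_succ, one_div]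
      ring
    · rw [pow_zero]
      ring
  · rw [goldenProd, if_neg fun h => h1 fun k => h (k + 1), goldenProd, if_neg h1, zero_rpow e₁,
      zero_mul]

/-- The `φ ^ n`-th root asymptotics of a sequence with `a (n + 2) = g n * a (n + 1) * a n`. -/
theorem tendsto_rpow_inv_goldenRatio_pow {a g : ℕ → ℝ} {c : ℝ} (hc : 0 < c)
    (hg : Tendsto g atTop (𝓝 c)) (ha0 : ∀ n, 0 ≤ a n)
    (ha : ∀ n, a (n + 2) = g n * a (n + 1) * a n) :
    Tendsto (fun n => a (n + 1) ^ (1 / goldenRatio ^ n)) atTop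
      (𝓝 (goldenProd g * a 1 ^ (goldenRatio / √5) * a 0 ^ (1 / √5))) := by
  have h5p : (0 : ℝ) < √5 := Real.sqrt_pos.2 (by norm_num)
  by_cases hpos : ∀ n, a n ≠ 0
  · have hgne : ∀ n, g n ≠ 0 := fun n h => hpos (n + 2) (by rw [ha, h, zero_mul, zero_mul])
    obtain ⟨B, hB⟩ := exists_abs_log_le hc hg
    have ht := (continuous_exp.tendsto _).comp
      (tendsto_div_goldenRatio_pow (u := fun n => log (a n)) hB fun n => by
        rw [ha, log_mul (mul_ne_zero (hgne n) (hpos _)) (hpos _), log_mul (hgne n) (hpos _)]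
        ring)
    have hp : ∀ n, 0 < a n := fun n => (ha0 n).lt_of_ne' (hpos n)
    have e : goldenProd g * a 1 ^ (goldenRatio / √5) * a 0 ^ (1 / √5) =
        exp (goldenRatio / √5 * log (a 1) + 1 / √5 * log (a 0) +
          ∑' k, goldenRatio⁻¹ ^ k / √5 * log (g k)) := by
      rw [goldenProd, if_pos hgne, rpow_def_of_pos (hp 1), rpow_def_of_pos (hp 0), ← exp_add,
        ← exp_add]
      ring_nf
    rw [e]
    refine ht.congr fun n => ?_
    rw [Function.comp_apply, rpow_def_of_pos (hp _)]
    ring_nf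
  -- One zero forces all terms from index m + 2 on to vanish. It also forces `a 0`, `a 1` or some `g
  -- k` to vanish, so the claimed limit is zero too.
  · obtain ⟨m, hm⟩ := not_forall_not.1 hpos
    have hz : ∀ n, a (m + 2 + n) = 0 := by
      intro n
      induction n with
      | zero => rw [add_zero, ha, hm, mul_zero]
      | succ n ih =>
        have := ha (m + 1 + n)
        rw [show m + 1 + n + 1 = m + 2 + n by ring, ih, mul_zero, zero_mul] at this
        rw [← this]
        ring_nf
    have hval : goldenProd g * a 1 ^ (goldenRatio / √5) * a 0 ^ (1 / √5) = 0 := by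
      by_contra hne
      have h0 : a 0 ≠ 0 := fun h => hne (by
        rw [h, zero_rpow (one_div_ne_zero h5p.ne'), mul_zero])
      have h1 : a 1 ≠ 0 := fun h => hne (by
        rw [h, zero_rpow (div_ne_zero goldenRatio_ne_zero h5p.ne'), mul_zero, zero_mul])
      have h2 : ∀ k, g k ≠ 0 := by
        by_contra hk
        rw [goldenProd, if_neg hk, zero_mul, zero_mul] at hne
        exact hne rfl
      have h3 : ∀ n, a n ≠ 0 ∧ a (n + 1) ≠ 0 := by
        intro n
        induction n with
        | zero => exact ⟨h0, h1⟩
        | succ n ih => exact ⟨ih.2, by rw [ha]; exact mul_ne_zero (mul_ne_zero (h2 n) ih.2) ih.1⟩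
      exact (h3 m).1 hm
    rw [hval]
    refine tendsto_const_nhds.congr' ?_
    filter_upwards [eventually_ge_atTop (m + 1)] with n hn
    have := hz (n - (m + 1))
    rw [show m + 2 + (n - (m + 1)) = n + 1 by omega] at this
    rw [this, zero_rpow (one_div_ne_zero (pow_ne_zero _ goldenRatio_ne_zero))]

end GoldenRecursion

/-! ### The limit on the basin and the local Böttcher-type function -/

namespace IsSimpleRootOn

variable {f : ℂ → ℂ} {U : Set ℂ} {z₀ : ℂ} {G : ℂ × ℂ → ℂ}

/-- The factor `G` along the orbit of a point of the basin. -/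
theorem tendsto_norm_secantFactor (h : IsSimpleRootOn f U z₀)
    (hG : AnalyticOnNhd ℂ G (secantDomain f U)) {p : ℂ × ℂ} (hp : p ∈ secantBasin f U z₀) :
    Tendsto (fun n => ‖G ((secantMap f)^[n] p)‖) atTop (𝓝 ‖G (z₀, z₀)‖) :=
  ((hG _ h.mem_secantDomain).continuousAt.tendsto.comp hp.2).norm

/-- The recursion is applied to the second coordinates, so that `a 0` comes from y and `a (n + 1)`
from the first coordinate of the n-th iterate. -/
theorem hasSecantLimit_goldenProd (h : IsSimpleRootOn f U z₀)
    (hG : AnalyticOnNhd ℂ G (secantDomain f U)) (hG0 : G (z₀, z₀) ≠ 0)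
    (hS : ∀ p ∈ secantDomain f U, secantMap f p = (z₀ + G p * (p.1 - z₀) * (p.2 - z₀), p.1))
    {p : ℂ × ℂ} (hp : p ∈ secantBasin f U z₀) :
    HasSecantLimit f z₀ p (goldenProd fun n => ‖G ((secantMap f)^[n] p)‖) := by
  have hsnd : ∀ n, ((secantMap f)^[n + 1] p).2 = ((secantMap f)^[n] p).1 := fun n => by
    rw [Function.iterate_succ_apply']
    rfl
  have hfst : ∀ n, ((secantMap f)^[n + 1] p).1 - z₀ = G ((secantMap f)^[n] p) *
      (((secantMap f)^[n] p).1 - z₀) * (((secantMap f)^[n] p).2 - z₀) := fun n => by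
    rw [Function.iterate_succ_apply', hS _ (hp.1 n)]
    ring
  have := tendsto_rpow_inv_goldenRatio_pow (a := fun n => ‖((secantMap f)^[n] p).2 - z₀‖)
    (norm_pos_iff.2 hG0) (h.tendsto_norm_secantFactor hG hp) (fun n => norm_nonneg _) (fun n => by
      rw [hsnd (n + 1), hfst n, norm_mul, norm_mul, hsnd])
  simp only [hsnd] at this
  exact this

/-- Off the axes, the limit determines the leading factor. -/
theorem _root_.HasSecantLimit.unique {p : ℂ × ℂ} {m m' : ℝ} (hm : HasSecantLimit f z₀ p m)
    (hm' : HasSecantLimit f z₀ p m') (h₁ : p.1 ≠ z₀) (h₂ : p.2 ≠ z₀) : m = m' := by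
  have h := tendsto_nhds_unique hm hm'
  have e₁ := Real.rpow_pos_of_pos (norm_pos_iff.2 (sub_ne_zero.2 h₁)) (Real.goldenRatio / √5)
  have e₂ := Real.rpow_pos_of_pos (norm_pos_iff.2 (sub_ne_zero.2 h₂)) (1 / √5)
  exact mul_right_cancel₀ e₁.ne' (mul_right_cancel₀ e₂.ne' h)

/-- On the axes the limit is zero whatever K is; there continuity and density of the complement
decide. -/
theorem eqOn_of_hasSecantLimit {s : Set (ℂ × ℂ)} (hs : IsOpen s) {K K' : ℂ × ℂ → ℝ}
    (hK : ContinuousOn K s) (hK' : ContinuousOn K' s) (hl : ∀ p ∈ s, HasSecantLimit f z₀ p (K p))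
    (hl' : ∀ p ∈ s, HasSecantLimit f z₀ p (K' p)) : Set.EqOn K K' s := by
  intro p hp
  refine eq_of_eventually_eq_off_axes (c := z₀) (hK.continuousAt (hs.mem_nhds hp))
    (hK'.continuousAt (hs.mem_nhds hp)) ?_
  filter_upwards [hs.mem_nhds hp] with q hq using (hl q hq).unique (hl' q hq)

/-- Near the fixed point, the modulus is that of an explicit zero-free holomorphic function. -/
theorem exists_norm_eq_goldenProd (h : IsSimpleRootOn f U z₀)
    (hG : AnalyticOnNhd ℂ G (secantDomain f U)) {w₀ : ℂ} (hw : Complex.exp w₀ = G (z₀, z₀)) :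
    ∃ (W : Set (ℂ × ℂ)) (H : ℂ × ℂ → ℂ), IsOpen W ∧ (z₀, z₀) ∈ W ∧ W ⊆ secantBasin f U z₀ ∧
      Set.MapsTo (secantMap f) W W ∧ AnalyticOnNhd ℂ H W ∧ (∀ p, H p ≠ 0) ∧
      H (z₀, z₀) = Complex.exp (((5 + 3 * √5) / 10 : ℝ) * w₀) ∧
      ∀ p ∈ W, ‖H p‖ = goldenProd fun n => ‖G ((secantMap f)^[n] p)‖ := by
  have hG0 : G (z₀, z₀) ≠ 0 := hw ▸ Complex.exp_ne_zero w₀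
  -- A logarithm of G with value w₀ at the centre: the quotient is 1 there, inside the slit plane.
  set ℓ : ℂ × ℂ → ℂ := fun p => w₀ + Complex.log (G p / G (z₀, z₀)) with hℓ
  have hGz := hG _ h.mem_secantDomain
  have hquot : AnalyticAt ℂ (fun p => G p / G (z₀, z₀)) (z₀, z₀) := hGz.div_const
  have hℓa : AnalyticAt ℂ ℓ (z₀, z₀) := by
    refine analyticAt_const.add (hquot.clog ?_)
    rw [div_self hG0]
    exact Complex.one_mem_slitPlane
  -- On an invariant W inside this set, ℓ is bounded along whole orbits, so the golden weights
  -- dominate the series.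
  have hN : ∀ᶠ p in 𝓝 (z₀, z₀), AnalyticAt ℂ ℓ p ∧ ‖ℓ p‖ < ‖ℓ (z₀, z₀)‖ + 1 ∧ G p ≠ 0 :=
    hℓa.eventually_analyticAt.and ((hℓa.continuousAt.norm.eventually_lt_const
      (lt_add_one _)).and (hGz.continuousAt.eventually_ne hG0))
  obtain ⟨W, hWo, hzW, hWN, hWb, hWm⟩ := h.exists_mapsTo_subset_secantBasin hN
  have hit : ∀ p ∈ W, ∀ n, (secantMap f)^[n] p ∈ W := fun p hp n => hWm.iterate n hp
  have hexp : ∀ p ∈ W, Complex.exp (ℓ p) = G p := by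
    intro p hp
    rw [hℓ, Complex.exp_add, hw, Complex.exp_log (div_ne_zero (hWN hp).2.2 hG0)]
    field_simp
  have hlog : ∀ p ∈ W, (ℓ p).re = Real.log ‖G p‖ := by
    intro p hp
    rw [← hexp p hp, Complex.norm_exp, Real.log_exp]
  set c : ℕ → ℝ := fun k => Real.goldenRatio⁻¹ ^ k / √5 with hc
  have hc0 : ∀ k, 0 ≤ c k := fun k =>
    div_nonneg (pow_nonneg inv_goldenRatio_pos.le _) (Real.sqrt_nonneg _)
  have hbound : ∀ k, ∀ p ∈ W, ‖(c k : ℂ) * ℓ ((secantMap f)^[k] p)‖ ≤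
      c k * (‖ℓ (z₀, z₀)‖ + 1) := by
    intro k p hp
    rw [norm_mul, Complex.norm_of_nonneg (hc0 k)]
    exact mul_le_mul_of_nonneg_left (hWN (hit p hp k)).2.1.le (hc0 k)
  have hsummable := summable_goldenWeight.mul_right (‖ℓ (z₀, z₀)‖ + 1)
  refine ⟨W, fun p => Complex.exp (∑' k, (c k : ℂ) * ℓ ((secantMap f)^[k] p)), hWo, hzW, hWb, hWm,
    ?_, fun p => Complex.exp_ne_zero _, ?_, ?_⟩
  · have := analyticOnNhd_tsum hWo hsummable (F := fun k p => (c k : ℂ) * ℓ ((secantMap f)^[k] p))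
      (fun k p hp => analyticAt_const.mul
        ((hWN (hit p hp k)).1.comp (h.analyticAt_iterate_secantMap (hWb hp) k))) hbound
    exact fun p hp => (this p hp).cexp
  · have hfix : ∀ k, (secantMap f)^[k] (z₀, z₀) = (z₀, z₀) := by
      intro k
      refine Function.iterate_fixed ?_ k
      exact Prod.ext (h.secantMap_fst_of_fst_eq h.mem_secantDomain rfl) rfl
    have hℓz : ℓ (z₀, z₀) = w₀ := by
      simp [hℓ, div_self hG0]
    simp only [hfix, hℓz]
    rw [tsum_mul_right, ← Complex.ofReal_tsum, tsum_goldenWeight]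
  · intro p hp
    have hsum : Summable fun k => (c k : ℂ) * ℓ ((secantMap f)^[k] p) :=
      Summable.of_norm_bounded hsummable fun k => hbound k p hp
    rw [Complex.norm_exp, Complex.re_tsum hsum, goldenProd,
      if_pos fun k => norm_ne_zero_iff.2 (hWN (hit p hp k)).2.2]
    congr 1
    refine tsum_congr fun k => ?_
    rw [Complex.re_ofReal_mul, hlog _ (hit p hp k)]

theorem goldenProd_secantFactor_eq (h : IsSimpleRootOn f U z₀)
    (hG : AnalyticOnNhd ℂ G (secantDomain f U)) (hG0 : G (z₀, z₀) ≠ 0) {p : ℂ × ℂ}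
    (hp : p ∈ secantBasin f U z₀) :
    (goldenProd fun n => ‖G ((secantMap f)^[n] p)‖) =
      (goldenProd fun n => ‖G ((secantMap f)^[n] (secantMap f p))‖) ^ (1 / Real.goldenRatio) *
        ‖G p‖ ^ (1 / √5) := by
  have := goldenProd_eq (norm_pos_iff.2 hG0) (h.tendsto_norm_secantFactor hG hp)
    fun n => norm_nonneg _
  simpa only [Function.iterate_succ_apply, Function.iterate_zero, id_eq] using this

/-- A property of points of the basin that holds near the fixed point and is inherited from
`S_f (p)` by `p` holds on the whole basin. -/
theorem secantBasin_induction {P : ℂ × ℂ → Prop} {W : Set (ℂ × ℂ)} (hWo : IsOpen W)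
    (hzW : (z₀, z₀) ∈ W) (hW : ∀ p ∈ W, P p)
    (hstep : ∀ p ∈ secantBasin f U z₀, P (secantMap f p) → P p) :
    ∀ p ∈ secantBasin f U z₀, P p := by
  intro p hp
  obtain ⟨N, hN⟩ := (hp.2.eventually (hWo.mem_nhds hzW)).exists
  induction N generalizing p with
  | zero => exact hW p hN
  | succ n ih => exact hstep p hp (ih _ (mapsTo_secantBasin hp) hN)

end IsSimpleRootOn

/-! ### Real-analyticity, and rigidity of the modulus -/

theorem AnalyticAt.rpow_const_of_ne {E : Type*} [NormedAddCommGroup E] [NormedSpace ℝ E]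
    {g : E → ℝ} {p : E} (hg : AnalyticAt ℝ g p) (h0 : g p ≠ 0) (r : ℝ) :
    AnalyticAt ℝ (fun q => g q ^ r) p := by
  have h1 : AnalyticAt ℝ (fun x : ℝ => x ^ r) (g p) :=
    (Real.contDiffAt_rpow_const_of_ne h0).analyticAt
  exact h1.comp hg

theorem AnalyticAt.norm_of_ne_zero {E : Type*} [NormedAddCommGroup E] [NormedSpace ℝ E] {g : E → ℂ}
    {p : E} (hg : AnalyticAt ℝ g p) (h0 : g p ≠ 0) : AnalyticAt ℝ (fun q => ‖g q‖) p := by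
  have h1 : AnalyticAt ℝ (fun q => (g q).re ^ 2 + (g q).im ^ 2) p :=
    (((Complex.reCLM.analyticAt _).comp hg).pow 2).add (((Complex.imCLM.analyticAt _).comp hg).pow 2)
  have h2 : (fun q => ‖g q‖) = fun q => √((g q).re ^ 2 + (g q).im ^ 2) := by
    ext q
    rw [Complex.norm_eq_sqrt_sq_add_sq]
  rw [h2]
  have hpos : 0 < (g p).re ^ 2 + (g p).im ^ 2 := by
    have := Complex.normSq_pos.2 h0
    rw [Complex.normSq_apply] at this
    nlinarith
  simp only [Real.sqrt_eq_rpow]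
  exact h1.rpow_const_of_ne hpos.ne' _

/-- Two holomorphic functions with equal moduli and equal nonzero value at `c` agree near `c`. -/
theorem eventuallyEq_of_norm_eq {E : Type*} [NormedAddCommGroup E] [NormedSpace ℂ E] {g k : E → ℂ}
    {c : E} (hg : AnalyticAt ℂ g c) (hk : AnalyticAt ℂ k c) (hc : g c = k c) (h0 : k c ≠ 0)
    (hn : ∀ᶠ p in 𝓝 c, ‖g p‖ = ‖k p‖) : g =ᶠ[𝓝 c] k := by
  obtain ⟨ε, hε, hs⟩ := Metric.mem_nhds_iff.1 ((hg.eventually_analyticAt.and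
    hk.eventually_analyticAt).and (hn.and (hk.continuousAt.eventually_ne h0)))
  -- The quotient has constant modulus 1, so the maximum principle makes it constant.
  have hq1 : ∀ p ∈ ball c ε, ‖g p / k p‖ = 1 := by
    intro p hp
    obtain ⟨-, h1, h2⟩ := hs hp
    rw [norm_div, h1, div_self (norm_ne_zero_iff.2 h2)]
  have hmax := Complex.eqOn_of_isPreconnected_of_isMaxOn_norm (f := fun p => g p / k p) (U := ball c ε)
    (convex_ball c ε).isPreconnected isOpen_ball
    (fun p hp => ((hs hp).1.1.div (hs hp).1.2
      (hs hp).2.2).differentiableAt.differentiableWithinAt)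
    (mem_ball_self hε) (fun p hp => by
      change ‖g p / k p‖ ≤ ‖g c / k c‖
      rw [hq1 p hp, hq1 c (mem_ball_self hε)])
  filter_upwards [ball_mem_nhds c hε] with p hp
  have := hmax hp
  simp only [Function.const_apply, hc, div_self h0] at this
  exact (div_eq_one_iff_eq (hs hp).2.2).1 this

/-- The limit fixes the modulus and the common value at (z₀, z₀) fixes the phase of the germ; the
identity theorem spreads equality over the component. -/
theorem IsBottcherFunction.eqOn {f : ℂ → ℂ} {U : Set ℂ} {z₀ w₀ : ℂ} {V₁ V₂ : Set (ℂ × ℂ)}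
    {H₁ H₂ : ℂ × ℂ → ℂ} (h₁ : IsBottcherFunction f U z₀ w₀ V₁ H₁)
    (h₂ : IsBottcherFunction f U z₀ w₀ V₂ H₂) :
    Set.EqOn H₁ H₂ (connectedComponentIn (V₁ ∩ V₂) (z₀, z₀)) := by
  obtain ⟨ho₁, hz₁, -, -, ha₁, hv₁, hl₁⟩ := h₁
  obtain ⟨ho₂, hz₂, -, -, ha₂, hv₂, hl₂⟩ := h₂
  have hsub := connectedComponentIn_subset (V₁ ∩ V₂) (z₀, z₀)
  refine AnalyticOnNhd.eqOn_of_preconnected_of_eventuallyEq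
    (fun p hp => ha₁ p (hsub hp).1) (fun p hp => ha₂ p (hsub hp).2) isPreconnected_connectedComponentIn
    (mem_connectedComponentIn ⟨hz₁, hz₂⟩) ?_
  have hn := IsSimpleRootOn.eqOn_of_hasSecantLimit (ho₁.inter ho₂)
    (K := fun p => ‖H₁ p‖) (K' := fun p => ‖H₂ p‖) (ha₁.continuousOn.norm.mono Set.inter_subset_left)
    (ha₂.continuousOn.norm.mono Set.inter_subset_right) (fun p hp => hl₁ p hp.1)
    (fun p hp => hl₂ p hp.2)
  refine eventuallyEq_of_norm_eq (ha₁ _ hz₁) (ha₂ _ hz₂) (hv₁.trans hv₂.symm)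
    (hv₂ ▸ Complex.exp_ne_zero _) ?_
  filter_upwards [(ho₁.inter ho₂).mem_nhds ⟨hz₁, hz₂⟩] with p hp using hn hp

/-! ### Assembly of the theorem -/

theorem theorem3p1 (U : Set ℂ) (hU : IsOpen U) (hUc : IsConnected U)
    (f : ℂ → ℂ) (hf : MeromorphicOn f U)
    (z₀ : ℂ) (hz₀ : z₀ ∈ U) (hroot : f z₀ = 0) (hsimple : deriv f z₀ ≠ 0)
    (hf2 : deriv (deriv f) z₀ ≠ 0) :
    -- existence
    (∀ w₀ : ℂ, Complex.exp w₀ = deriv (deriv f) z₀ / (2 * deriv f z₀) →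
      ∃ (V : Set (ℂ × ℂ)) (H : ℂ × ℂ → ℂ), IsBottcherFunction f U z₀ w₀ V H) ∧
    -- uniqueness
    (∀ w₀ : ℂ, Complex.exp w₀ = deriv (deriv f) z₀ / (2 * deriv f z₀) →
      ∀ (V₁ V₂ : Set (ℂ × ℂ)) (H₁ H₂ : ℂ × ℂ → ℂ),
        IsBottcherFunction f U z₀ w₀ V₁ H₁ → IsBottcherFunction f U z₀ w₀ V₂ H₂ →
        Set.EqOn H₁ H₂ (connectedComponentIn (V₁ ∩ V₂) (z₀, z₀))) ∧
    -- the modulus on the whole basin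
    (∃ K : ℂ × ℂ → ℝ,
      ContinuousOn K (secantBasin f U z₀) ∧
      (∀ p ∈ secantBasin f U z₀, HasSecantLimit f z₀ p (K p)) ∧
      (∀ w₀ : ℂ, Complex.exp w₀ = deriv (deriv f) z₀ / (2 * deriv f z₀) →
        ∀ (V : Set (ℂ × ℂ)) (H : ℂ × ℂ → ℂ), IsBottcherFunction f U z₀ w₀ V H →
          ∀ p ∈ V, K p = ‖H p‖) ∧
      (∀ K' : ℂ × ℂ → ℝ, ContinuousOn K' (secantBasin f U z₀) →
        (∀ p ∈ secantBasin f U z₀, HasSecantLimit f z₀ p (K' p)) →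
        Set.EqOn K' K (secantBasin f U z₀)) ∧
      -- the functional equation and real-analyticity
      (∃ G : ℂ × ℂ → ℂ,
        IsSecantFactor f U z₀ G ∧
        G (z₀, z₀) = deriv (deriv f) z₀ / (2 * deriv f z₀) ∧
        (∀ G' : ℂ × ℂ → ℂ, IsSecantFactor f U z₀ G' → Set.EqOn G' G (secantBasin f U z₀)) ∧
        ∀ p ∈ secantBasin f U z₀,
          K p = K (secantMap f p) ^ (1 / Real.goldenRatio : ℝ) * ‖G p‖ ^ (1 / √5 : ℝ)) ∧
      ∀ p ∈ secantBasin f U z₀, K p ≠ 0 → AnalyticAt ℝ K p) := by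
  have h : IsSimpleRootOn f U z₀ := ⟨hU, hUc, hf, hz₀, hroot, hsimple⟩
  obtain ⟨G, hG, hS⟩ := h.exists_secantFactor
  have hGz : G (z₀, z₀) = deriv (deriv f) z₀ / (2 * deriv f z₀) :=
    h.secantFactor_apply (hG _ h.mem_secantDomain) <| by
      filter_upwards [h.isOpen_secantDomain.mem_nhds h.mem_secantDomain] with q hq using hS q hq
  have hG0 : G (z₀, z₀) ≠ 0 := by
    rw [hGz]
    exact div_ne_zero hf2 (mul_ne_zero two_ne_zero hsimple)
  have hbo := h.isOpen_secantBasin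
  set K : ℂ × ℂ → ℝ := fun p => goldenProd fun n => ‖G ((secantMap f)^[n] p)‖ with hKdef
  have hlim : ∀ p ∈ secantBasin f U z₀, HasSecantLimit f z₀ p (K p) := fun p hp =>
    h.hasSecantLimit_goldenProd hG hG0 hS hp
  have hfun : ∀ p ∈ secantBasin f U z₀,
      K p = K (secantMap f p) ^ (1 / Real.goldenRatio : ℝ) * ‖G p‖ ^ (1 / √5 : ℝ) := fun p hp =>
    h.goldenProd_secantFactor_eq hG hG0 hp
  have hGb : AnalyticOnNhd ℂ G (secantBasin f U z₀) := hG.mono IsSimpleRootOn.secantBasin_subset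
  have hφ : 0 < 1 / Real.goldenRatio := one_div_pos.2 Real.goldenRatio_pos
  have h5 : (0 : ℝ) < 1 / √5 := one_div_pos.2 (Real.sqrt_pos.2 (by norm_num))
  have hev : ∀ p ∈ secantBasin f U z₀, K =ᶠ[𝓝 p] fun q =>
      K (secantMap f q) ^ (1 / Real.goldenRatio : ℝ) * ‖G q‖ ^ (1 / √5 : ℝ) := fun p hp => by
    filter_upwards [hbo.mem_nhds hp] with q hq using hfun q hq
  -- Any logarithm serves here, since only |H| is used.
  obtain ⟨W, H, hWo, hzW, -, -, hHa, hH0, -, hHK⟩ :=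
    h.exists_norm_eq_goldenProd hG (Complex.exp_log hG0)
  have hKH : ∀ p ∈ W, K =ᶠ[𝓝 p] fun q => ‖H q‖ := fun p hp => by
    filter_upwards [hWo.mem_nhds hp] with q hq using (hHK q hq).symm
  have hKc : ContinuousOn K (secantBasin f U z₀) := fun p hp => by
    refine ContinuousAt.continuousWithinAt ?_
    -- The functional equation pulls continuity back from S_f(p) to p; its exponents are positive,
    -- so zeros do no harm.
    refine IsSimpleRootOn.secantBasin_induction (P := fun p => ContinuousAt K p) hWo hzW
      (fun p hp => ?_) (fun p hp ih => ?_) p hp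
    · exact (hHa p hp).continuousAt.norm.congr (hKH p hp).symm
    · refine ContinuousAt.congr ?_ (hev p hp).symm
      exact ((ih.comp (h.analyticAt_secantMap (hp.1 0)).continuousAt).rpow_const
        (Or.inr hφ.le)).mul ((hGb p hp).continuousAt.norm.rpow_const (Or.inr h5.le))
  refine ⟨fun w₀ hw => ?_, fun w₀ _ V₁ V₂ H₁ H₂ h₁ h₂ => h₁.eqOn h₂, K, hKc, hlim, ?_, ?_,
    ⟨G, ⟨hGb, fun p hp => hS p (hp.1 0)⟩, hGz, ?_, hfun⟩, ?_⟩
  · obtain ⟨V, F, hVo, hzV, hVb, hVm, hFa, -, hFz, hFK⟩ :=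
      h.exists_norm_eq_goldenProd hG (hw.trans hGz.symm)
    exact ⟨V, F, hVo, hzV, hVb, hVm, hFa, hFz, fun p hp => hFK p hp ▸ hlim p (hVb hp)⟩
  · rintro w₀ - V F ⟨hVo, -, hVb, -, hFa, -, hFl⟩
    exact IsSimpleRootOn.eqOn_of_hasSecantLimit hVo (hKc.mono hVb) hFa.continuousOn.norm
      (fun p hp => hlim p (hVb hp)) hFl
  · intro K' hK'c hK'l
    exact IsSimpleRootOn.eqOn_of_hasSecantLimit hbo hK'c hKc hK'l hlim
  · rintro G' ⟨hG'a, hG'S⟩ p hp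
    refine eq_of_eventually_eq_off_axes (c := z₀) (hG'a p hp).continuousAt
      (hGb p hp).continuousAt ?_
    filter_upwards [hbo.mem_nhds hp] with q hq hq₁ hq₂
    have := congrArg Prod.fst ((hG'S q hq).symm.trans (hS q (hq.1 0)))
    exact mul_right_cancel₀ (sub_ne_zero.2 hq₁)
      (mul_right_cancel₀ (sub_ne_zero.2 hq₂) (add_left_cancel this))
  -- If K p ≠ 0, both factors of the functional equation are nonzero at p, where real powers and the
  -- modulus are real-analytic.
  · refine IsSimpleRootOn.secantBasin_induction hWo hzW (fun p hp _ => ?_) (fun p hp ih hK0 => ?_)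
    · exact ((hHa p hp).restrictScalars.norm_of_ne_zero (hH0 p)).congr (hKH p hp).symm
    · have hK0' := hK0
      rw [hfun p hp] at hK0'
      have hKS : K (secantMap f p) ≠ 0 := fun h0 => hK0' (by
        rw [h0, Real.zero_rpow hφ.ne', zero_mul])
      have hGp : G p ≠ 0 := fun h0 => hK0' (by
        rw [h0, norm_zero, Real.zero_rpow h5.ne', mul_zero])
      refine AnalyticAt.congr ?_ (hev p hp).symm
      exact (((ih hKS).comp (h.analyticAt_secantMap (hp.1 0)).restrictScalars).rpow_const_of_ne
        hKS _).mul (((hGb p hp).restrictScalars.norm_of_ne_zero hGp).rpow_const_of_ne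
          (norm_ne_zero_iff.2 hGp) _)
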